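/- Let $I=(a,\infty)$ with $-\infty\le a<\infty$, let $J=[-\tfrac12,\tfrac12]$, and let $D\subset\mathbb R^n$ be open. Dynamic functions. A dynamic function on an open interval $\Omega\subset I$ assigns to each $t\in\Omega$ a function $x(t)(\cdot)$ on $J$ (an ordinary value, if it is constant); its one-sided limits $x(t\pm)$ are understood uniformly in $s\in J$; it is continuous at $t$ if $x(t)(\cdot)$ is an ordinary value equal to $x(t+)=x(t-)$, and $T(x)$ is the set of its discontinuities; $\hat x$ denotes its ordinary part (the ordinary values). Dynamic test functions on $\Omega$ are the real dynamic functions $\varphi$ with compact support in $\Omega$ whose values $\varphi(t)(\cdot)$ are regulated on $J$ and which have one-sided limits at every point; a distribution is evaluated on them. Write $x\in s\mathbb{BV}^{\rm loc}_n(\Omega)$ if every $x(t)(\cdot)$ is absolutely continuous on $J$ with $x(t)(\mp\frac12)=x(t\mp)$, $\hat x$ has locally bounded variation and the variations over $J$ of the values $x(t)(\cdot)$ are locally summable over $t$. For such (scalar) $x$, with $x_c$ the continuous part of $\hat x$, $$(\dot x,\varphi)=\int\hat\varphi\,dx_c+\sum_{\tau\in T(x)}\int_J\varphi(\tau)(s)\,\tfrac{d}{ds}x(\tau)(s)\,ds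 .$$ Locally summable functions act by $(h,\varphi)=\int h\hat\varphi\,dt$, delta-functions by $(\delta_\tau^\alpha,\varphi)=\int_J\alpha(s)\varphi(\tau)(s)\,ds$, and products are defined by $(hv,\varphi)=(v,h\varphi)$; for vector-valued objects everything is meant componentwise, and $\langle\cdot,\cdot\rangle$ is the componentwise product in $\mathbb R^n$. The system. Consider $$\dot x=f(x)+g(x)v,\qquad v=w+\sum_{k=1}^\infty\langle c_k,\delta_{\tau_k}^{\alpha_k}\rangle ,$$ where $f:D\to\mathbb R^n$ and $g:D\to\mathbb R^{n\times n}$ are Lipschitz, $w:I\to\mathbb R^n$ is continuous, $\tau_k\in I$, $c_k\in\mathbb R^n$, $\alpha_k:J\to\mathbb R^n$ is continuous and each of its components has integral $1$ over $J$, and $v$ has a primitive in $s\mathbb{BV}^{\rm loc}_n(I)$. A solution on an open interval $\Omega\subset I$ is an $x\in s\mathbb{BV}^{\rm loc}_n(\Omega)$ with $x(t)(s)\in D$ for all $t\in\Omega$, $s\in J$ that satisfies the equation on every test function on $\Omega$. Let $x^*\in D$ be an equilibrium point, i.e. the constant $x^*$ is a solution on $I$. Corollary. Let $a\le t_0$.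 Suppose that $$\bigl(x-x^*,\,f(x)+g(x)w(t)\bigr)\le 0\quad\text{for all } t>t_0,$$ $$\bigl(x-x^*,\,g(x)\langle c_k,\alpha_k(s)\rangle\bigr)\le 0\quad\text{for all } s\in J,\ k\in\mathbb N,$$ for all $l\in\mathbb N$, $l\ge1$, and all $x\in D$ with $|x-x^*|_2=1/l$ (Euclidean norm). Then $x^*$ is uniformly stable for initial moments $t_1\in I$, $t_1\ge t_0$: there are closed neighbourhoods $D\supset M_0\supset M_1\supset\cdots$ of $x^*$, each neighbourhood of $x^*$ containing some $M_k$, such that for every $l$ there is $k\ge l$ with the property that, for each initial moment $t_1\in I$, $t_1\ge t_0$, each solution $x$ on an open interval $\Omega\subset I$ with $t_1\in\Omega$ and $x(t_1-)\in M_k$ satisfies $x(t)(s)\in M_l$ for all $t\in\Omega$, $t\ge t_1$, and all $s\in J$. -/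

import Mathlib

open Set Filter Topology MeasureTheory

noncomputable section

namespace DynDist

/-- The interval `J = [-1/2, 1/2]` that parametrizes dynamic values. -/
def J : Set ℝ := Icc (-(1 / 2)) (1 / 2)

/-- The interval `(a, ∞)`, where `a` may be `-∞`. -/
def ray (a : EReal) : Set ℝ := {t : ℝ | a < (t : EReal)}

/-- A dynamic function `t ↦ (s ↦ x t s)`. Only the values at `s ∈ J`, and at `t` in the interval
under consideration, matter. -/
abbrev DynFun (E : Type*) := ℝ → ℝ → E

section Basic

variable {E : Type*} [NormedAddCommGroup E]

/-- `x(t)(·)` is an ordinary value, i.e. it is constant on `J`. -/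
def IsOrdinaryAt (x : DynFun E) (t : ℝ) : Prop := ∀ s ∈ J, ∀ r ∈ J, x t s = x t r

/-- The ordinary part. At ordinary points it is the ordinary value; at the remaining (at most
countably many) points, where the ordinary part is not defined, the value `x(t)(0)` is a mere
convention. -/
def ord (x : DynFun E) : ℝ → E := fun t => x t 0

/-- `x(t+) = l`: convergence as `r → t+`, uniformly in `s ∈ J`. -/
def HasRightLim (x : DynFun E) (t : ℝ) (l : E) : Prop :=
  Tendsto (fun p : ℝ × ℝ => x p.1 p.2) (𝓝[>] t ×ˢ 𝓟 J) (𝓝 l)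

/-- `x(t-) = l`: convergence as `r → t-`, uniformly in `s ∈ J`. -/
def HasLeftLim (x : DynFun E) (t : ℝ) (l : E) : Prop :=
  Tendsto (fun p : ℝ × ℝ => x p.1 p.2) (𝓝[<] t ×ˢ 𝓟 J) (𝓝 l)

/-- The set `T(x)` of points of discontinuity: `x` is continuous at `t` if `x(t)(·)` is an ordinary
value and `x(t) = x(t+) = x(t-)`. -/
def discSet (x : DynFun E) : Set ℝ :=
  {t | ¬ (IsOrdinaryAt x t ∧ HasRightLim x t (ord x t) ∧ HasLeftLim x t (ord x t))}

/-- Dynamic functions of locally bounded variation on the open interval `Ω`: the dynamic values are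
absolutely continuous on `J` and run from `x(t-)` to `x(t+)`, the ordinary part is of locally bounded
variation, and the variations of the dynamic values are locally summable
(they vanish at ordinary points). -/
structure IsLocSBV (Ω : Set ℝ) (x : DynFun E) : Prop where
  absCont : ∀ t ∈ Ω, AbsolutelyContinuousOnInterval (x t) (-(1 / 2)) (1 / 2)
  leftLim : ∀ t ∈ Ω, HasLeftLim x t (x t (-(1 / 2)))
  rightLim : ∀ t ∈ Ω, HasRightLim x t (x t (1 / 2))
  locBV : LocallyBoundedVariationOn (ord x) Ω
  summable : ∀ p q : ℝ, Icc p q ⊆ Ω → ∑' t : Icc p q, eVariationOn (x t) J ≠ ⊤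

end Basic

/-- Regulated functions on `J`: one-sided limits exist at all points of `J`. -/
def RegulatedOnJ (h : ℝ → ℝ) : Prop :=
  (∀ s ∈ Ico (-(1 / 2) : ℝ) (1 / 2), ∃ l, Tendsto h (𝓝[>] s) (𝓝 l)) ∧
  (∀ s ∈ Ioc (-(1 / 2) : ℝ) (1 / 2), ∃ l, Tendsto h (𝓝[<] s) (𝓝 l))

/-- Dynamic test functions with support in `[p, q]`, extended by zero to the real line: regulated
dynamic functions that vanish outside `[p, q]`. The dynamic test functions on an open interval `Ω` are
those with support in some `[p, q] ⊆ Ω`. -/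
structure IsTest (p q : ℝ) (φ : DynFun ℝ) : Prop where
  regulated : ∀ t, RegulatedOnJ (φ t)
  rightLim : ∀ t, ∃ l, HasRightLim φ t l
  leftLim : ∀ t, ∃ l, HasLeftLim φ t l
  support : ∀ t, t ∉ Icc p q → ∀ s ∈ J, φ t s = 0

/-- The regular distribution `φ ↦ ∫ h(t) φ̂(t) dt`, where `φ̂` is the ordinary part of `φ`. -/
def regularPair (h : ℝ → ℝ) (φ : DynFun ℝ) : ℝ := ∫ t, h t * ord φ t

/-- The delta-function at `τ` of shape `α`, `φ ↦ ∫_J α(s) φ(τ)(s) ds`. -/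
def deltaPair (τ : ℝ) (α : ℝ → ℝ) (φ : DynFun ℝ) : ℝ :=
  ∫ s in (-(1 / 2) : ℝ)..(1 / 2), α s * φ τ s

/-- The function `h` on `[p, q]`, extended by the constants `h p` and `h q`. -/
def clamp (p q : ℝ) (h : ℝ → ℝ) : ℝ → ℝ := fun t => h (max p (min t q))

open scoped Classical in
/-- `∫ φ̂ dy_c` for `φ` with support in `[p, q]`, where `y_c` is the continuous part of the ordinary
part of `y`. The Lebesgue-Stieltjes measure of `y_c` on `[p, q]` is the restriction of the one of the
ordinary part of `y` to the complement of the countable set of the discontinuities of `y`. -/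
def contPair (p q : ℝ) (y φ : DynFun ℝ) : ℝ :=
  if h : BoundedVariationOn (clamp p q (ord y)) univ then
    (h.vectorMeasure.restrict (Icc p q \ discSet y)).integral (ord φ)
      (ContinuousLinearMap.lsmul ℝ ℝ)
  else 0

/-- The derivative of `y` as a distribution, evaluated at a test function `φ` with support in
`[p, q]`: `∫ φ̂ dy_c + ∑_{τ ∈ T(y)} ∫_J φ(τ)(s) (y(τ)(s))˙ ds`. -/
def derivPair (p q : ℝ) (y φ : DynFun ℝ) : ℝ :=
  contPair p q y φ + ∑' τ : ↥(discSet y ∩ Icc p q),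
    ∫ s in (-(1 / 2) : ℝ)..(1 / 2), φ τ s * deriv (y τ) s

section System

variable {n : ℕ}

/-- The data of the distribution `v = w + ∑ₖ ⟨cₖ, δ_{τₖ}^{αₖ}⟩` with values in `ℝⁿ`. -/
structure Impulse (n : ℕ) where
  /-- the ordinary summand -/
  w : ℝ → EuclideanSpace ℝ (Fin n)
  /-- the coefficients of the delta-functions -/
  c : ℕ → EuclideanSpace ℝ (Fin n)
  /-- the points at which the delta-functions are concentrated -/
  τ : ℕ → ℝ
  /-- the (vector-valued) shapes of the delta-functions -/
  α : ℕ → ℝ → EuclideanSpace ℝ (Fin n)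

/-- The value of the `j`-th component of `v` at `φ`. -/
def Impulse.pair (v : Impulse n) (j : Fin n) (φ : DynFun ℝ) : ℝ :=
  regularPair (fun t => v.w t j) φ + ∑' k, v.c k j * deltaPair (v.τ k) (fun s => v.α k s j) φ

/-- `u` is a primitive in the space of distributions on `Ω` of `v = w + ∑ₖ ⟨cₖ, δ_{τₖ}^{αₖ}⟩`, the
series being convergent in that space (i.e. on every test function). -/
def Impulse.IsPrimitive (v : Impulse n) (Ω : Set ℝ) (u : DynFun (EuclideanSpace ℝ (Fin n))) : Prop :=
  ∀ p q : ℝ, Icc p q ⊆ Ω → ∀ φ, IsTest p q φ → ∀ j,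
    HasSum (fun k => v.c k j * deltaPair (v.τ k) (fun s => v.α k s j) φ)
      (derivPair p q (fun t s => u t s j) φ - regularPair (fun t => v.w t j) φ)

/-- The admissible `v` on `Ω`: `w` is continuous, `τₖ ∈ Ω`, the shapes are continuous on `J` with
integral one, and `v` has a primitive of locally bounded variation. -/
structure Impulse.Admissible (v : Impulse n) (Ω : Set ℝ) : Prop where
  continuous_w : ContinuousOn v.w Ω
  mem : ∀ k, v.τ k ∈ Ω
  continuous_shape : ∀ k, ContinuousOn (v.α k) J
  integral_shape : ∀ k j, ∫ s in (-(1 / 2) : ℝ)..(1 / 2), v.α k s j = 1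
  primitive : ∃ u, IsLocSBV Ω u ∧ v.IsPrimitive Ω u

/-- `x` is a solution on the open interval `Ω` of `ẋ = f(x) + g(x) v`: a dynamic function of locally
bounded variation on `Ω` with values in `D` such that the equation holds on every test function on `Ω`.
The product of the dynamic function `g(x)` and the distribution `v` is given by
`(g v, φ) = (v, g φ)`. -/
structure IsSolution (D : Set (EuclideanSpace ℝ (Fin n)))
    (f : EuclideanSpace ℝ (Fin n) → EuclideanSpace ℝ (Fin n))
    (g : EuclideanSpace ℝ (Fin n) → Matrix (Fin n) (Fin n) ℝ) (v : Impulse n)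
    (Ω : Set ℝ) (x : DynFun (EuclideanSpace ℝ (Fin n))) : Prop where
  sbv : IsLocSBV Ω x
  mem : ∀ t ∈ Ω, ∀ s ∈ J, x t s ∈ D
  eqn : ∀ p q : ℝ, Icc p q ⊆ Ω → ∀ φ, IsTest p q φ → ∀ i,
    derivPair p q (fun t s => x t s i) φ =
      regularPair (fun t => f (ord x t) i) φ +
        ∑ j, v.pair j (fun t s => g (x t s) i j * φ t s)

/-- Uniform stability of `xs` for `ẋ = f(x) + g(x) v` on the open interval `I`, with initial moments
in `S ⊆ I`: there are closed neighbourhoods `M 0 ⊇ M 1 ⊇ …` of `xs` in `D`, shrinking to `xs`, such that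
for each `l` there is `k ≥ l` such that each solution with `x(t₁-) ∈ M k` at an initial moment `t₁ ∈ S`
is viable in `M l`, i.e. all its (dynamic) values at moments `t ≥ t₁` lie in `M l`. -/
def UniformlyStable (D : Set (EuclideanSpace ℝ (Fin n)))
    (f : EuclideanSpace ℝ (Fin n) → EuclideanSpace ℝ (Fin n))
    (g : EuclideanSpace ℝ (Fin n) → Matrix (Fin n) (Fin n) ℝ) (v : Impulse n)
    (I S : Set ℝ) (xs : EuclideanSpace ℝ (Fin n)) : Prop :=
  ∃ M : ℕ → Set (EuclideanSpace ℝ (Fin n)),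
    (∀ k, IsClosed (M k)) ∧ Antitone M ∧ (∀ k, M k ⊆ D) ∧ (∀ k, M k ∈ 𝓝 xs) ∧
    (∀ U ∈ 𝓝 xs, ∃ k, M k ⊆ U) ∧
    ∀ l, ∃ k, l ≤ k ∧ ∀ t₁ ∈ S, ∀ Ω : Set ℝ, IsOpen Ω → Ω.OrdConnected → Ω ⊆ I → t₁ ∈ Ω →
      ∀ x x₀, IsSolution D f g v Ω x → HasLeftLim x t₁ x₀ → x₀ ∈ M k →
        ∀ t ∈ Ω, t₁ ≤ t → ∀ s ∈ J, x t s ∈ M l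

/-- The componentwise product in `ℝⁿ`. -/
def cmul (a b : EuclideanSpace ℝ (Fin n)) : EuclideanSpace ℝ (Fin n) :=
  WithLp.toLp 2 fun i => a i * b i

/-- The product of a matrix and a vector of `ℝⁿ`. -/
def mulV (A : Matrix (Fin n) (Fin n) ℝ) (b : EuclideanSpace ℝ (Fin n)) :
    EuclideanSpace ℝ (Fin n) :=
  WithLp.toLp 2 (A.mulVec b)

end System

end DynDist

end

noncomputable section

namespace DynDist

/-! Every closed ball around `xs` of radius `1 / l` contained in `D` is positively invariant
(`IsSolution.mem_closedBall`). These balls shrink to `xs`, so they can serve as the neighbourhoods,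
with `k = l`.

Time is the set of pairs `(t, s)` in lexicographic order: each moment `t` is blown up to a copy of
`J`, and a solution moves along its dynamic value as `s` grows. Testing the equation on the
indicator of a lexicographic interval yields the increment of the solution over it
(`derivPair_region`, `derivPair_region_self`).

Let `X` and `X'` be the values at the two ends of such an interval, `X'` outside the ball. The
coefficients are frozen at the point `z` of the sphere nearest to `X'`, and the increment is
projected on the outer normal at `z`. The frozen part is nonpositive by the tangency conditions
(`Impulse.Admissible.frozen_pair_nonpos`). The remainder is at most a Lipschitz constant times the
distance of the solution from `z` times the mass of the interval under one finite measure, built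
from Lebesgue measure and the derivative of a primitive of `v` (`IsLocSBV.exists_measure`,
`IsSolution.exists_measure_increment`).

If the solution oscillates by at most `η` on the interval, that distance is at most the excess of
`X` over the ball plus `2 * η`. This is a one-step Gronwall inequality
(`IsSolution.exists_measure_excess`). Its exponential factors multiply along consecutive intervals,
and a continuation argument gives excess at most `2 * η * exp (C * m)` at all later times. Letting
`η` tend to zero leaves excess zero. -/

lemma neg_half_mem_J : (-(1 / 2) : ℝ) ∈ J := ⟨le_rfl, by norm_num⟩

lemma half_mem_J : (1 / 2 : ℝ) ∈ J := ⟨by norm_num, le_rfl⟩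

lemma zero_mem_J : (0 : ℝ) ∈ J := ⟨by norm_num, by norm_num⟩

lemma uIcc_eq_J : uIcc (-(1 / 2) : ℝ) (1 / 2) = J := uIcc_of_le (by norm_num)

/-! ### Limits, continuity and coordinates of dynamic functions -/

section Basic

variable {E F : Type*} [NormedAddCommGroup E] [NormedAddCommGroup F] {Ω : Set ℝ} {x : DynFun E}

lemma HasRightLim.tendsto_apply {t s : ℝ} {l : E} (h : HasRightLim x t l) (hs : s ∈ J) :
    Tendsto (fun r => x r s) (𝓝[>] t) (𝓝 l) :=
  h.comp (tendsto_id.prodMk (tendsto_const_pure.mono_right (by simpa using hs)))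

lemma HasLeftLim.tendsto_apply {t s : ℝ} {l : E} (h : HasLeftLim x t l) (hs : s ∈ J) :
    Tendsto (fun r => x r s) (𝓝[<] t) (𝓝 l) :=
  h.comp (tendsto_id.prodMk (tendsto_const_pure.mono_right (by simpa using hs)))

lemma HasLeftLim.unique {t : ℝ} {l l' : E} (h : HasLeftLim x t l) (h' : HasLeftLim x t l') :
    l = l' :=
  tendsto_nhds_unique (h.tendsto_apply zero_mem_J) (h'.tendsto_apply zero_mem_J)

lemma IsLocSBV.continuousOn (hx : IsLocSBV Ω x) {t : ℝ} (ht : t ∈ Ω) : ContinuousOn (x t) J :=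
  uIcc_eq_J ▸ (hx.absCont t ht).continuousOn

/-- The points of continuity are exactly the ordinary points. -/
lemma IsLocSBV.mem_discSet (hx : IsLocSBV Ω x) {t : ℝ} (ht : t ∈ Ω) :
    t ∈ discSet x ↔ ¬ IsOrdinaryAt x t := by
  refine not_congr ⟨fun h => h.1, fun h => ⟨h, ?_, ?_⟩⟩
  · have := hx.rightLim t ht
    rwa [h _ half_mem_J _ zero_mem_J] at this
  · have := hx.leftLim t ht
    rwa [h _ neg_half_mem_J _ zero_mem_J] at this

/-- A value that is not ordinary has positive variation over `J`, and a family in `ENNReal` with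
finite sum has countable support. -/
lemma IsLocSBV.countable_discSet (hx : IsLocSBV Ω x) {p q : ℝ} (hpq : Icc p q ⊆ Ω) :
    (discSet x ∩ Icc p q).Countable := by
  have h := (Summable.countable_support_ennreal (hx.summable p q hpq)).image Subtype.val
  refine h.mono fun t ht => (mem_image _ _ _).2 ⟨⟨t, ht.2⟩, fun h0 => ?_, rfl⟩
  refine (hx.mem_discSet (hpq ht.2)).1 ht.1 fun s hs r hr => ?_
  have := (eVariationOn.edist_le (x t) hs hr).trans_eq h0
  exact edist_le_zero.1 this

lemma AbsolutelyContinuousOnInterval.comp_lipschitzWith_one {f : ℝ → E} {h : E → F} {a b : ℝ}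
    (hf : AbsolutelyContinuousOnInterval f a b) (hh : LipschitzWith 1 h) :
    AbsolutelyContinuousOnInterval (fun s => h (f s)) a b := by
  refine squeeze_zero (fun _ => Finset.sum_nonneg fun _ _ => dist_nonneg)
    (fun _ => Finset.sum_le_sum fun _ _ => ?_) hf
  simpa using hh.dist_le_mul _ _

lemma IsLocSBV.comp_lipschitzWith_one (hx : IsLocSBV Ω x) {h : E → F} (hh : LipschitzWith 1 h) :
    IsLocSBV Ω (fun t s => h (x t s)) where
  absCont t ht :=
    AbsolutelyContinuousOnInterval.comp_lipschitzWith_one (hx.absCont t ht) hh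
  leftLim t ht := (hh.continuous.tendsto _).comp (hx.leftLim t ht)
  rightLim t ht := (hh.continuous.tendsto _).comp (hx.rightLim t ht)
  locBV := fun a b ha hb => by
    refine ne_top_of_le_ne_top (hx.locBV a b ha hb) ?_
    simpa using! (hh.lipschitzOnWith (s := univ)).comp_eVariationOn_le
      (mapsTo_univ (ord x) (Ω ∩ Icc a b))
  summable p q hpq := by
    refine ne_top_of_le_ne_top (hx.summable p q hpq) (ENNReal.tsum_le_tsum fun t => ?_)
    simpa using! (hh.lipschitzOnWith (s := univ)).comp_eVariationOn_le (mapsTo_univ (x t) J)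

lemma IsLocSBV.boundedVariationOn_Icc (hx : IsLocSBV Ω x) {p q : ℝ} (hpq : Icc p q ⊆ Ω) (h : p ≤ q) :
    BoundedVariationOn (ord x) (Icc p q) := by
  have := hx.locBV p q (hpq ⟨le_rfl, h⟩) (hpq ⟨h, le_rfl⟩)
  rwa [inter_eq_right.2 hpq] at this

lemma IsLocSBV.coord {n : ℕ} {x : DynFun (EuclideanSpace ℝ (Fin n))} (hx : IsLocSBV Ω x)
    (i : Fin n) : IsLocSBV Ω (fun t s => x t s i) :=
  hx.comp_lipschitzWith_one (h := fun v : EuclideanSpace ℝ (Fin n) => v i) <|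
    LipschitzWith.of_dist_le_mul fun a b => by
      simpa [dist_eq_norm] using PiLp.norm_apply_le (a - b) i

end Basic

/-! ### The Stieltjes measure of the ordinary part -/

section Stieltjes

variable {Ω : Set ℝ} {y : DynFun ℝ} {p q : ℝ}

lemma clamp_eq_of_mem {h : ℝ → ℝ} {t : ℝ} (ht : t ∈ Icc p q) : clamp p q h t = h t := by
  rw [clamp, min_eq_left ht.2, max_eq_right ht.1]

lemma IsLocSBV.boundedVariationOn_clamp (hy : IsLocSBV Ω y) (hpq : Icc p q ⊆ Ω) (h : p ≤ q) :
    BoundedVariationOn (clamp p q (ord y)) univ := by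
  refine ne_top_of_le_ne_top (hy.boundedVariationOn_Icc hpq h)
    (eVariationOn.comp_le_of_monotoneOn (ord y) (fun t => max p (min t q)) ?_ ?_)
  · exact fun a _ b _ hab => max_le_max le_rfl (min_le_min hab le_rfl)
  · exact fun t _ => ⟨le_max_left _ _, max_le h (min_le_right _ _)⟩

lemma IsLocSBV.rightLim_clamp (hy : IsLocSBV Ω y) (hpq : Icc p q ⊆ Ω) {t : ℝ} (ht : t ∈ Ico p q) :
    (clamp p q (ord y)).rightLim t = y t (1 / 2) := by
  refine rightLim_eq_of_tendsto ?_
  refine ((hy.rightLim t (hpq ⟨ht.1, ht.2.le⟩)).tendsto_apply zero_mem_J).congr' ?_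
  filter_upwards [Ioo_mem_nhdsGT ht.2] with r hr
  exact (clamp_eq_of_mem (h := ord y) ⟨ht.1.trans hr.1.le, hr.2.le⟩).symm

lemma IsLocSBV.leftLim_clamp (hy : IsLocSBV Ω y) (hpq : Icc p q ⊆ Ω) {t : ℝ} (ht : t ∈ Ioc p q) :
    (clamp p q (ord y)).leftLim t = y t (-(1 / 2)) := by
  refine leftLim_eq_of_tendsto ?_
  refine ((hy.leftLim t (hpq ⟨ht.1.le, ht.2⟩)).tendsto_apply zero_mem_J).congr' ?_
  filter_upwards [Ioo_mem_nhdsLT ht.1] with r hr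
  exact (clamp_eq_of_mem (h := ord y) ⟨hr.1.le, hr.2.le.trans ht.2⟩).symm

/-- The atom is the difference of the one-sided limits of the clamped function. At an endpoint of
`[p, q]` the outer limit is the constant extension, which agrees with the ordinary value. -/
lemma IsLocSBV.vectorMeasure_singleton_of_ordinary (hy : IsLocSBV Ω y) (hpq : Icc p q ⊆ Ω)
    (h : BoundedVariationOn (clamp p q (ord y)) univ) {t : ℝ} (ht : t ∈ Icc p q)
    (ho : IsOrdinaryAt y t) : h.vectorMeasure {t} = 0 := by
  have hr : (clamp p q (ord y)).rightLim t = y t 0 := by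
    rcases ht.2.lt_or_eq with hlt | rfl
    · rw [hy.rightLim_clamp hpq ⟨ht.1, hlt⟩, ho _ half_mem_J _ zero_mem_J]
    · refine rightLim_eq_of_tendsto (tendsto_const_nhds.congr' ?_)
      filter_upwards [self_mem_nhdsWithin] with r (hr : t < r)
      simp [clamp, ord, min_eq_right hr.le, ht.1]
  have hl : (clamp p q (ord y)).leftLim t = y t 0 := by
    rcases ht.1.lt_or_eq with hlt | rfl
    · rw [hy.leftLim_clamp hpq ⟨hlt, ht.2⟩, ho _ neg_half_mem_J _ zero_mem_J]
    · refine leftLim_eq_of_tendsto (tendsto_const_nhds.congr' ?_)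
      filter_upwards [self_mem_nhdsWithin] with r (hr : r < p)
      simp [clamp, ord, min_eq_left (hr.le.trans ht.2), hr.le]
  rw [h.vectorMeasure_singleton, hr, hl, sub_self]

instance isFiniteMeasure_variation (ν : VectorMeasure ℝ ℝ) : IsFiniteMeasure ν.variation := by
  rw [← SignedMeasure.totalVariation_eq_variation]
  infer_instance

lemma contPair_eq (hy : IsLocSBV Ω y) (hpq : Icc p q ⊆ Ω) (h : p ≤ q) (φ : DynFun ℝ) :
    contPair p q y φ = ((hy.boundedVariationOn_clamp hpq h).vectorMeasure.restrict
      (Icc p q \ discSet y)).integral (ord φ) (ContinuousLinearMap.lsmul ℝ ℝ) := by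
  rw [contPair, dif_pos]

lemma IsLocSBV.measurableSet_disc (hy : IsLocSBV Ω y) (hpq : Icc p q ⊆ Ω) :
    MeasurableSet (Icc p q \ discSet y) := by
  have : Icc p q \ discSet y = Icc p q \ (discSet y ∩ Icc p q) := by ext; grind
  rw [this]
  exact measurableSet_Icc.diff (hy.countable_discSet hpq).measurableSet

lemma contPair_of_ord_eq_indicator (hy : IsLocSBV Ω y) (hpq : Icc p q ⊆ Ω) (h : p ≤ q)
    {φ : DynFun ℝ} {S : Set ℝ} (hS : MeasurableSet S) (hφ : ord φ = S.indicator 1) :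
    contPair p q y φ = (hy.boundedVariationOn_clamp hpq h).vectorMeasure
      ((Icc p q \ discSet y) ∩ S) := by
  have hm := hy.measurableSet_disc hpq
  rw [contPair_eq hy hpq h, hφ]
  have := VectorMeasure.setIntegral_indicator (B := ContinuousLinearMap.lsmul ℝ ℝ)
    (μ := (hy.boundedVariationOn_clamp hpq h).vectorMeasure) (f := fun _ => (1 : ℝ)) hm hS
  refine this.trans ?_
  rw [VectorMeasure.integral_const, VectorMeasure.restrict_apply _ (hm.inter hS) .univ]
  simp

end Stieltjes

/-! ### Indicators of lexicographic intervals as test functions -/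

/-- The part `{(t, s) | a < t < b} ∪ {b} × (s, s']` of the time domain. -/
def region (a b s s' : ℝ) : Set (ℝ × ℝ) := Ioo a b ×ˢ univ ∪ {b} ×ˢ Ioc s s'

/-- The dynamic indicator function of a set of pairs `(t, s)`. -/
def dynIndicator (R : Set (ℝ × ℝ)) : DynFun ℝ := fun t s => R.indicator 1 (t, s)

lemma measurableSet_region (a b s s' : ℝ) : MeasurableSet (region a b s s') :=
  (measurableSet_Ioo.prod .univ).union ((measurableSet_singleton b).prod measurableSet_Ioc)

lemma dynIndicator_nonneg (R : Set (ℝ × ℝ)) (t s : ℝ) : 0 ≤ dynIndicator R t s :=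
  indicator_nonneg (fun _ _ => zero_le_one) _

section

variable {a b s s' : ℝ}

lemma dynIndicator_region_of_mem {t : ℝ} (ht : t ∈ Ioo a b) :
    dynIndicator (region a b s s') t = fun _ => 1 := by
  funext r
  exact indicator_of_mem (s := region a b s s') (Or.inl ⟨ht, mem_univ _⟩) _

lemma dynIndicator_region_right : dynIndicator (region a b s s') b = (Ioc s s').indicator 1 := by
  funext r
  by_cases hr : r ∈ Ioc s s'
  · rw [indicator_of_mem hr]
    exact indicator_of_mem (s := region a b s s') (Or.inr ⟨mem_singleton b, hr⟩) _
  · rw [indicator_of_notMem hr]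
    refine indicator_of_notMem (s := region a b s s') ?_ _
    rintro (⟨h, -⟩ | ⟨-, h⟩)
    exacts [lt_irrefl _ h.2, hr h]

lemma dynIndicator_region_of_notMem {t : ℝ} (ht : t ∉ Ioo a b) (hb : t ≠ b) :
    dynIndicator (region a b s s') t = fun _ => 0 := by
  funext r
  refine indicator_of_notMem (s := region a b s s') ?_ _
  rintro (⟨h, -⟩ | ⟨h, -⟩)
  exacts [ht h, hb h]

lemma regulatedOnJ_const (c : ℝ) : RegulatedOnJ fun _ => c :=
  ⟨fun _ _ => ⟨c, tendsto_const_nhds⟩, fun _ _ => ⟨c, tendsto_const_nhds⟩⟩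

lemma tendsto_nhds_of_eventually_const {f : ℝ → ℝ} {l : Filter ℝ} {c : ℝ} (h : ∀ᶠ r in l, f r = c) :
    ∃ c, Tendsto f l (𝓝 c) :=
  ⟨c, tendsto_const_nhds.congr' (h.mono fun _ hr => hr.symm)⟩

lemma regulatedOnJ_indicator_Ioc : RegulatedOnJ ((Ioc s s').indicator (1 : ℝ → ℝ)) := by
  constructor
  · intro r _
    by_cases h : r ∈ Ico s s'
    · refine tendsto_nhds_of_eventually_const (c := 1) ?_
      filter_upwards [Ioo_mem_nhdsGT h.2] with u hu
      exact indicator_of_mem (s := Ioc s s') ⟨h.1.trans_lt hu.1, hu.2.le⟩ _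
    · refine tendsto_nhds_of_eventually_const (c := 0) ?_
      rw [mem_Ico, not_and_or, not_le, not_lt] at h
      rcases h with h | h
      · filter_upwards [Ioo_mem_nhdsGT h] with u hu
        exact indicator_of_notMem (fun hu' => absurd hu'.1 hu.2.not_gt) _
      · filter_upwards [self_mem_nhdsWithin] with u (hu : r < u)
        exact indicator_of_notMem (fun hu' => absurd hu'.2 (h.trans_lt hu).not_ge) _
  · intro r _
    by_cases h : r ∈ Ioc s s'
    · refine tendsto_nhds_of_eventually_const (c := 1) ?_
      filter_upwards [Ioo_mem_nhdsLT h.1] with u hu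
      exact indicator_of_mem (s := Ioc s s') ⟨hu.1, hu.2.le.trans h.2⟩ _
    · refine tendsto_nhds_of_eventually_const (c := 0) ?_
      rw [mem_Ioc, not_and_or, not_lt, not_le] at h
      rcases h with h | h
      · filter_upwards [self_mem_nhdsWithin] with u (hu : u < r)
        exact indicator_of_notMem (fun hu' => absurd hu'.1 (hu.trans_le h).not_gt) _
      · filter_upwards [Ioo_mem_nhdsLT h] with u hu
        exact indicator_of_notMem (fun hu' => absurd hu'.2 hu.1.not_ge) _

lemma hasRightLim_of_eventually {φ : DynFun ℝ} {t c : ℝ} (h : ∀ᶠ r in 𝓝[>] t, ∀ s ∈ J, φ r s = c) :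
    HasRightLim φ t c := by
  refine tendsto_const_nhds.congr' ?_
  filter_upwards [prod_mem_prod h (mem_principal_self J)] with z hz
  exact (hz.1 z.2 hz.2).symm

lemma hasLeftLim_of_eventually {φ : DynFun ℝ} {t c : ℝ} (h : ∀ᶠ r in 𝓝[<] t, ∀ s ∈ J, φ r s = c) :
    HasLeftLim φ t c := by
  refine tendsto_const_nhds.congr' ?_
  filter_upwards [prod_mem_prod h (mem_principal_self J)] with z hz
  exact (hz.1 z.2 hz.2).symm

lemma isTest_dynIndicator_region {p q : ℝ} (ha : p ≤ a) (hab : a ≤ b) (hb : b ≤ q) :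
    IsTest p q (dynIndicator (region a b s s')) where
  regulated t := by
    by_cases h : t ∈ Ioo a b
    · rw [dynIndicator_region_of_mem h]
      exact regulatedOnJ_const 1
    · by_cases hb : t = b
      · rw [hb, dynIndicator_region_right]
        exact regulatedOnJ_indicator_Ioc
      · rw [dynIndicator_region_of_notMem h hb]
        exact regulatedOnJ_const 0
  rightLim t := by
    by_cases h : t ∈ Ico a b
    · refine ⟨1, hasRightLim_of_eventually ?_⟩
      filter_upwards [Ioo_mem_nhdsGT h.2] with r hr s _
      rw [dynIndicator_region_of_mem ⟨h.1.trans_lt hr.1, hr.2⟩]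
    · refine ⟨0, hasRightLim_of_eventually ?_⟩
      rw [mem_Ico, not_and_or, not_le, not_lt] at h
      rcases h with h | h
      · filter_upwards [Ioo_mem_nhdsGT h] with r hr s _
        rw [dynIndicator_region_of_notMem (fun hr' => absurd hr'.1 hr.2.not_gt)
          (hr.2.trans_le hab).ne]
      · filter_upwards [self_mem_nhdsWithin] with r (hr : t < r) s _
        rw [dynIndicator_region_of_notMem (fun hr' => absurd hr'.2 (h.trans hr.le).not_gt)
          (h.trans_lt hr).ne']
  leftLim t := by
    by_cases h : t ∈ Ioc a b
    · refine ⟨1, hasLeftLim_of_eventually ?_⟩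
      filter_upwards [Ioo_mem_nhdsLT h.1] with r hr s _
      rw [dynIndicator_region_of_mem ⟨hr.1, hr.2.trans_le h.2⟩]
    · refine ⟨0, hasLeftLim_of_eventually ?_⟩
      rw [mem_Ioc, not_and_or, not_lt, not_le] at h
      rcases h with h | h
      · filter_upwards [self_mem_nhdsWithin] with r (hr : r < t) s _
        rw [dynIndicator_region_of_notMem (fun hr' => absurd hr'.1 (hr.trans_le h).not_gt)
          ((hr.trans_le h).trans_le hab).ne]
      · filter_upwards [Ioo_mem_nhdsLT h] with r hr s _
        rw [dynIndicator_region_of_notMem (fun hr' => absurd hr'.2 hr.1.not_gt) hr.1.ne']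
  support t ht s _ := by
    rw [dynIndicator_region_of_notMem
      (fun h => ht ⟨ha.trans h.1.le, h.2.le.trans hb⟩)
      (fun h => ht ⟨h ▸ ha.trans hab, h ▸ hb⟩)]

lemma integral_indicator_mul_deriv {f : ℝ → ℝ}
    (hf : AbsolutelyContinuousOnInterval f (-(1 / 2)) (1 / 2)) (hs : s ∈ J) (hs' : s' ∈ J)
    (h : s ≤ s') :
    ∫ r in (-(1 / 2) : ℝ)..(1 / 2), (Ioc s s').indicator 1 r * deriv f r = f s' - f s := by
  have hfs : AbsolutelyContinuousOnInterval f s s' := hf.mono (by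
    rw [uIcc_of_le h, uIcc_eq_J]
    exact Icc_subset_Icc hs.1 hs'.2)
  rw [← hfs.integral_deriv_eq_sub, intervalIntegral.integral_of_le (by norm_num),
    intervalIntegral.integral_of_le h]
  have : (fun r => (Ioc s s').indicator 1 r * deriv f r) = (Ioc s s').indicator (deriv f) := by
    funext r
    by_cases hr : r ∈ Ioc s s' <;> simp [hr]
  rw [this, setIntegral_indicator measurableSet_Ioc,
    inter_eq_right.2 (Ioc_subset_Ioc hs.1 hs'.2)]

variable {Ω : Set ℝ} {y : DynFun ℝ} {p q : ℝ}

lemma IsLocSBV.integral_deriv (hy : IsLocSBV Ω y) {t : ℝ} (ht : t ∈ Ω) :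
    ∫ r in (-(1 / 2) : ℝ)..(1 / 2), deriv (y t) r = y t (1 / 2) - y t (-(1 / 2)) :=
  (hy.absCont t ht).integral_deriv_eq_sub

/-- The continuous part sees the Stieltjes measure off the discontinuities. Each discontinuity
inside `(a, b)` is covered by its whole fibre, so its term is exactly the missing atom, and together
they give the measure of `(a, b)`. The last fibre contributes only the increment over `(s, s']`. -/
lemma derivPair_region_eq (hy : IsLocSBV Ω y) (hpq : Icc p q ⊆ Ω) (h : p ≤ q)
    (ha : p ≤ a) (hab : a ≤ b) (hb : b ≤ q) (hs : s ∈ J) (hs' : s' ∈ J) (hss' : s ≤ s') :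
    derivPair p q y (dynIndicator (region a b s s')) =
      (hy.boundedVariationOn_clamp hpq h).vectorMeasure (Ioo a b) + (y b s' - y b s) := by
  set ν := (hy.boundedVariationOn_clamp hpq h).vectorMeasure with hν
  have hbm : b ∈ Icc p q := ⟨ha.trans hab, hb⟩
  have hIoo : Ioo a b ⊆ Icc p q := fun t ht => ⟨ha.trans ht.1.le, ht.2.le.trans hb⟩
  have hcount : (discSet y ∩ Ioo a b).Countable :=
    (hy.countable_discSet hpq).mono (inter_subset_inter_right _ hIoo)
  have hdiff : MeasurableSet (Ioo a b \ discSet y) := by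
    have : Ioo a b \ discSet y = Ioo a b \ (discSet y ∩ Ioo a b) := by ext; grind
    rw [this]
    exact measurableSet_Ioo.diff hcount.measurableSet
  -- the continuous part
  have hcont : contPair p q y (dynIndicator (region a b s s')) = ν (Ioo a b \ discSet y) := by
    have hS : MeasurableSet {t : ℝ | (t, (0 : ℝ)) ∈ region a b s s'} :=
      (measurable_id.prodMk measurable_const) (measurableSet_region a b s s')
    rw [contPair_of_ord_eq_indicator hy hpq h hS (by rfl)]
    -- The ordinary part of the indicator is read off at `s = 0`, so `b` enters the continuous part
    -- when it is an ordinary point and `0 ∈ Ioc s s'`. It then carries no mass.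
    by_cases hc : b ∉ discSet y ∧ 0 ∈ Ioc s s'
    · have : Icc p q \ discSet y ∩ {t : ℝ | (t, (0 : ℝ)) ∈ region a b s s'} =
          (Ioo a b \ discSet y) ∪ {b} := by
        ext t
        constructor
        · rintro ⟨⟨-, h1⟩, ⟨h2, -⟩ | ⟨h2, -⟩⟩
          exacts [Or.inl ⟨h2, h1⟩, Or.inr h2]
        · rintro (⟨h1, h2⟩ | rfl)
          exacts [⟨⟨hIoo h1, h2⟩, Or.inl ⟨h1, mem_univ _⟩⟩, ⟨⟨hbm, hc.1⟩, Or.inr ⟨rfl, hc.2⟩⟩]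
      rw [this, VectorMeasure.of_union (by simp) hdiff (measurableSet_singleton b),
        hy.vectorMeasure_singleton_of_ordinary hpq _ hbm
          (not_not.1 fun h' => hc.1 ((hy.mem_discSet (hpq hbm)).2 h')), add_zero]
    · congr 1
      ext t
      constructor
      · rintro ⟨⟨-, h1⟩, ⟨h2, -⟩ | ⟨rfl, h2⟩⟩
        exacts [⟨h2, h1⟩, absurd ⟨h1, h2⟩ hc]
      · rintro ⟨h1, h2⟩
        exact ⟨⟨hIoo h1, h2⟩, Or.inl ⟨h1, mem_univ _⟩⟩
  -- the jumps
  have hjump : HasSum (fun τ : ↥(discSet y ∩ Ioo a b) => y τ (1 / 2) - y τ (-(1 / 2)))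
      (ν (discSet y ∩ Ioo a b)) := by
    have := hcount.to_subtype
    have hsum := VectorMeasure.hasSum_of_disjoint_iUnion (v := ν)
      (f := fun τ : ↥(discSet y ∩ Ioo a b) => {(τ : ℝ)}) (fun _ => measurableSet_singleton _)
      (fun τ τ' hne => by simpa [Function.onFun, Subtype.ext_iff] using hne)
    rw [iUnion_of_singleton_coe] at hsum
    have e : (fun τ : ↥(discSet y ∩ Ioo a b) => y τ (1 / 2) - y τ (-(1 / 2))) =
        fun τ : ↥(discSet y ∩ Ioo a b) => ν {(τ : ℝ)} := by
      funext τ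
      have hτ := τ.2.2
      rw [hν, BoundedVariationOn.vectorMeasure_singleton,
        hy.rightLim_clamp hpq ⟨ha.trans hτ.1.le, hτ.2.trans_le hb⟩,
        hy.leftLim_clamp hpq ⟨ha.trans_lt hτ.1, hτ.2.le.trans hb⟩]
    rw [e]
    exact hsum
  have htsum : ∑' τ : ↥(discSet y ∩ Icc p q), ∫ r in (-(1 / 2) : ℝ)..(1 / 2),
      dynIndicator (region a b s s') τ r * deriv (y τ) r =
      ν (discSet y ∩ Ioo a b) + (y b s' - y b s) := by
    have hjump := (hasSum_subtype_iff_indicator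
      (f := fun τ => y τ (1 / 2) - y τ (-(1 / 2)))).1 hjump
    -- The term at `b` is kept apart. If `b` is ordinary, it is absent from the sum over
    -- discontinuities, but its increment vanishes too.
    have h2 := hjump.add (hasSum_ite_eq b (y b s' - y b s))
    rw [← h2.tsum_eq, tsum_subtype (discSet y ∩ Icc p q) fun τ =>
      ∫ r in (-(1 / 2) : ℝ)..(1 / 2), dynIndicator (region a b s s') τ r * deriv (y τ) r]
    congr 1
    funext τ
    rcases eq_or_ne τ b with rfl | hne
    · rw [indicator_of_notMem (s := discSet y ∩ Ioo a τ) (fun h' => lt_irrefl _ h'.2.2), zero_add,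
        if_pos rfl]
      by_cases hd : τ ∈ discSet y
      · rw [indicator_of_mem (s := discSet y ∩ Icc p q) ⟨hd, hbm⟩, dynIndicator_region_right,
          integral_indicator_mul_deriv (hy.absCont τ (hpq hbm)) hs hs' hss']
      · rw [indicator_of_notMem fun h' => hd h'.1, eq_comm, sub_eq_zero]
        exact not_not.1 (fun h' => hd ((hy.mem_discSet (hpq hbm)).2 h')) _ hs' _ hs
    · rw [if_neg hne, add_zero]
      by_cases hd : τ ∈ discSet y ∩ Ioo a b
      · rw [indicator_of_mem hd, indicator_of_mem (s := discSet y ∩ Icc p q) ⟨hd.1, hIoo hd.2⟩,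
          dynIndicator_region_of_mem hd.2, ← hy.integral_deriv (hpq (hIoo hd.2))]
        simp
      · rw [indicator_of_notMem hd]
        by_cases hd' : τ ∈ discSet y ∩ Icc p q
        · rw [indicator_of_mem hd', dynIndicator_region_of_notMem (fun h' => hd ⟨hd'.1, h'⟩) hne]
          simp
        · rw [indicator_of_notMem hd']
  rw [derivPair, hcont, htsum, ← add_assoc, ← VectorMeasure.of_union _ hdiff hcount.measurableSet]
  · congr 2
    ext; grind
  · exact disjoint_left.2 fun t ht ht' => ht.2 ht'.1

/-- The interval excludes the fibre over `a`, so it starts from the right limit there; the left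
limit at `b` cancels against the start of the last fibre. -/
lemma derivPair_region (hy : IsLocSBV Ω y) (hpq : Icc p q ⊆ Ω)
    (ha : p ≤ a) (hab : a < b) (hb : b ≤ q) (hs' : s' ∈ J) :
    derivPair p q y (dynIndicator (region a b (-(1 / 2)) s')) = y b s' - y a (1 / 2) := by
  rw [derivPair_region_eq hy hpq (ha.trans (hab.le.trans hb)) ha hab.le hb neg_half_mem_J hs' hs'.1,
    BoundedVariationOn.vectorMeasure_Ioo _ hab, hy.rightLim_clamp hpq ⟨ha, hab.trans_le hb⟩,
    hy.leftLim_clamp hpq ⟨ha.trans_lt hab, hb⟩]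
  ring

lemma derivPair_region_self (hy : IsLocSBV Ω y) (hpq : Icc p q ⊆ Ω)
    (ha : a ∈ Icc p q) (hs : s ∈ J) (hs' : s' ∈ J) (hss' : s ≤ s') :
    derivPair p q y (dynIndicator (region a a s s')) = y a s' - y a s := by
  rw [derivPair_region_eq hy hpq (ha.1.trans ha.2) ha.1 le_rfl ha.2 hs hs' hss']
  simp

end

/-! ### Domination of distributional derivatives by finite measures -/

/-- The variation function `V` is monotone, its increments dominate those of `f`, hence `|f'| ≤ V'`
almost everywhere; and the integral of the derivative of a monotone function is at most its
increment. -/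
lemma lintegral_enorm_deriv_le_eVariationOn {f : ℝ → ℝ} {a b : ℝ} (hab : a ≤ b)
    (hf : BoundedVariationOn f (Icc a b)) :
    ∫⁻ s in Ioc a b, ‖deriv f s‖ₑ ≤ eVariationOn f (Icc a b) := by
  have hloc := hf.locallyBoundedVariationOn
  have ham : a ∈ Icc a b := ⟨le_rfl, hab⟩
  set V := variationOnFromTo f (Icc a b) a with hV
  have hVm : MonotoneOn V (Icc a b) := variationOnFromTo.monotoneOn hloc ham
  have hVm' : MonotoneOn V (uIcc a b) := by rwa [uIcc_of_le hab]
  have hle : ∀ u ∈ Icc a b, ∀ w ∈ Icc a b, u ≤ w → |f w - f u| ≤ V w - V u := by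
    intro u hu w hw huw
    have h1 := variationOnFromTo.add hloc ham hu hw
    have h2 : V w - V u = variationOnFromTo f (Icc a b) u w := by rw [hV]; linarith
    rw [h2, variationOnFromTo.eq_of_le f (Icc a b) huw, ← Real.dist_eq]
    exact (hf.mono inter_subset_left).dist_le ⟨hw, huw, le_rfl⟩ ⟨hu, le_rfl, huw⟩
  have hae : ∀ᵐ x ∂volume.restrict (Ioc a b), ‖deriv f x‖ ≤ deriv V x := by
    rw [ae_restrict_iff' measurableSet_Ioc]
    have hb : ∀ᵐ x : ℝ, x ≠ b := by simp [ae_iff, measure_singleton]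
    filter_upwards [hloc.ae_differentiableWithinAt_of_mem,
      hVm.ae_differentiableWithinAt_of_mem, hb] with x h1 h2 hxb hx
    have hxI : x ∈ Ioo a b := ⟨hx.1, hx.2.lt_of_ne hxb⟩
    have hnhds : Icc a b ∈ 𝓝 x := Icc_mem_nhds hxI.1 hxI.2
    have hxc : x ∈ Icc a b := Ioo_subset_Icc_self hxI
    have d1 := (((h1 hxc).differentiableAt hnhds).hasDerivAt.tendsto_slope.mono_left
      (nhdsWithin_mono x (s := Ioi x) fun w (hw : x < w) => hw.ne')).norm
    have d2 := ((h2 hxc).differentiableAt hnhds).hasDerivAt.tendsto_slope.mono_left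
      (nhdsWithin_mono x (s := Ioi x) fun w (hw : x < w) => hw.ne')
    refine le_of_tendsto_of_tendsto d1 d2 ?_
    filter_upwards [Ioo_mem_nhdsGT hxI.2] with w hw
    have hwx : 0 < w - x := sub_pos.2 hw.1
    rw [slope_def_field, slope_def_field, norm_div, Real.norm_of_nonneg hwx.le]
    gcongr
    exact hle x hxc w ⟨hxc.1.trans hw.1.le, hw.2.le⟩ hw.1.le
  have hint : IntegrableOn (deriv V) (Ioc a b) :=
    (intervalIntegrable_iff_integrableOn_Ioc_of_le hab).1 hVm'.intervalIntegrable_deriv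
  have hval : ∫ x in Ioc a b, deriv V x ≤ V b - V a := by
    have := hVm'.intervalIntegral_deriv_mem_uIcc
    rw [intervalIntegral.integral_of_le hab,
      uIcc_of_le (sub_nonneg.2 (hVm ham ⟨hab, le_rfl⟩ hab))] at this
    exact this.2
  calc ∫⁻ s in Ioc a b, ‖deriv f s‖ₑ ≤ ∫⁻ s in Ioc a b, ENNReal.ofReal (deriv V s) := by
        refine lintegral_mono_ae (hae.mono fun x hx => ?_)
        rw [← ofReal_norm]
        exact ENNReal.ofReal_le_ofReal hx
    _ = ENNReal.ofReal (∫ x in Ioc a b, deriv V x) :=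
        (ofReal_integral_eq_lintegral_ofReal hint
          (hae.mono fun x hx => (norm_nonneg _).trans hx)).symm
    _ ≤ ENNReal.ofReal (V b - V a) := ENNReal.ofReal_le_ofReal hval
    _ = eVariationOn f (Icc a b) := by
        rw [hV, variationOnFromTo.self, sub_zero, variationOnFromTo.eq_of_le _ _ hab, inter_self,
          ENNReal.ofReal_toReal hf]

/-- The derivative of a dynamic function of locally bounded variation is dominated by a finite
measure on the set of pairs `(t, s)`. -/
lemma IsLocSBV.exists_measure {Ω : Set ℝ} {y : DynFun ℝ} {p q : ℝ} (hy : IsLocSBV Ω y)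
    (hpq : Icc p q ⊆ Ω) (h : p ≤ q) :
    ∃ m : Measure (ℝ × ℝ), IsFiniteMeasure m ∧
      ∀ (ψ : DynFun ℝ) (R : Set (ℝ × ℝ)) (ε : ℝ), MeasurableSet R → 0 ≤ ε →
        (∀ t ∈ Icc p q, ∀ s ∈ J, |ψ t s| ≤ ε * dynIndicator R t s) →
        |derivPair p q y ψ| ≤ ε * m.real R := by
  set ν := (hy.boundedVariationOn_clamp hpq h).vectorMeasure
  have hA := hy.measurableSet_disc hpq
  -- The continuous part sees a test function only through its values at `s = 0`, so its variation
  -- measure is placed on that line.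
  set m₁ := (ν.variation.restrict (Icc p q \ discSet y)).map (fun t => (t, (0 : ℝ))) with hm₁
  -- Each discontinuity `τ` carries the density `|d/ds y(τ)(s)|` on its fibre; summability of the
  -- variations makes the total mass finite.
  set m₂ : ↥(discSet y ∩ Icc p q) → Measure (ℝ × ℝ) := fun τ =>
    ((volume.restrict (Ioc (-(1 / 2)) (1 / 2))).withDensity fun s => ‖deriv (y τ) s‖ₑ).map
      (fun s => ((τ : ℝ), s)) with hm₂
  have hmeas₁ : Measurable fun t : ℝ => (t, (0 : ℝ)) := measurable_id.prodMk measurable_const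
  have hmeas₂ : ∀ τ : ℝ, Measurable fun s : ℝ => (τ, s) := fun τ =>
    measurable_const.prodMk measurable_id
  have hfin : IsFiniteMeasure (m₁ + Measure.sum m₂) := by
    have : IsFiniteMeasure (Measure.sum m₂) := by
      refine ⟨?_⟩
      rw [Measure.sum_apply _ .univ]
      refine lt_of_le_of_lt (b := ∑' t : Icc p q, eVariationOn (y t) J) ?_
        (hy.summable p q hpq).lt_top
      refine le_trans (ENNReal.tsum_le_tsum (g := fun τ : ↥(discSet y ∩ Icc p q) =>
        eVariationOn (y τ) J) fun τ => ?_) ?_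
      · rw [hm₂, Measure.map_apply (hmeas₂ τ) .univ, preimage_univ, withDensity_apply _ .univ,
          Measure.restrict_univ]
        have hbv := (hy.absCont τ (hpq τ.2.2)).boundedVariationOn
        rw [uIcc_eq_J] at hbv
        exact lintegral_enorm_deriv_le_eVariationOn (by norm_num) hbv
      · exact ENNReal.tsum_mono_subtype (fun t => eVariationOn (y t) J) inter_subset_right
    infer_instance
  refine ⟨m₁ + Measure.sum m₂, hfin, fun ψ R ε hR hε hψ => ?_⟩
  have henorm : ∀ t ∈ Icc p q, ∀ s ∈ J, ‖ψ t s‖ₑ ≤ ENNReal.ofReal ε * R.indicator 1 (t, s) := by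
    intro t ht s hs
    rw [← ofReal_norm, Real.norm_eq_abs]
    refine (ENNReal.ofReal_le_ofReal (hψ t ht s hs)).trans ?_
    rw [ENNReal.ofReal_mul hε, dynIndicator]
    by_cases hz : (t, s) ∈ R <;> simp [hz]
  have hcont : ‖contPair p q y ψ‖ₑ ≤ ENNReal.ofReal ε * m₁ R := by
    rw [contPair_eq hy hpq h]
    refine VectorMeasure.enorm_integral_le_lintegral_enorm.trans ?_
    rw [VectorMeasure.variation_restrict hA]
    have hB : ‖(ContinuousLinearMap.lsmul ℝ ℝ : ℝ →L[ℝ] ℝ →L[ℝ] ℝ)‖ₑ ≤ 1 := by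
      rw [← ofReal_norm]
      exact ENNReal.ofReal_le_one.2 ContinuousLinearMap.opNorm_lsmul_le
    calc _ ≤ 1 * ∫⁻ t in Icc p q \ discSet y, ENNReal.ofReal ε * R.indicator 1 (t, (0 : ℝ))
          ∂ν.variation := by
          refine mul_le_mul' hB (setLIntegral_mono' hA fun t ht => ?_)
          exact henorm t ht.1 0 zero_mem_J
      _ = ENNReal.ofReal ε * m₁ R := by
          rw [one_mul, lintegral_const_mul' _ _ ENNReal.ofReal_ne_top, hm₁,
            Measure.map_apply hmeas₁ hR, ← lintegral_indicator_one (hmeas₁ hR)]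
          rfl
  have hjump : ∀ τ : ↥(discSet y ∩ Icc p q),
      ‖∫ s in (-(1 / 2) : ℝ)..(1 / 2), ψ τ s * deriv (y τ) s‖ₑ ≤ ENNReal.ofReal ε * m₂ τ R := by
    intro τ
    rw [intervalIntegral.integral_of_le (by norm_num)]
    refine (enorm_integral_le_lintegral_enorm _).trans ?_
    rw [hm₂, Measure.map_apply (hmeas₂ τ) hR, withDensity_apply _ (hmeas₂ τ hR),
      ← lintegral_indicator (hmeas₂ τ hR), ← lintegral_const_mul' _ _ ENNReal.ofReal_ne_top]
    refine setLIntegral_mono' measurableSet_Ioc fun s hs => ?_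
    rw [enorm_mul]
    refine (mul_le_mul' (henorm τ τ.2.2 s ⟨hs.1.le, hs.2⟩) le_rfl).trans_eq ?_
    rw [mul_assoc]
    congr 1
    by_cases hz : ((τ : ℝ), s) ∈ R
    · rw [indicator_of_mem hz, indicator_of_mem (by exact hz)]
      simp
    · rw [indicator_of_notMem hz, indicator_of_notMem (by exact hz), zero_mul]
  have hfinal : ‖derivPair p q y ψ‖ₑ ≤ ENNReal.ofReal ε * (m₁ + Measure.sum m₂) R := by
    rw [derivPair, Measure.add_apply, Measure.sum_apply _ hR, mul_add]
    refine (enorm_add_le _ _).trans (add_le_add hcont ?_)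
    refine enorm_tsum_le_tsum_enorm.trans ?_
    rw [← ENNReal.tsum_mul_left]
    exact ENNReal.tsum_le_tsum hjump
  have := ENNReal.toReal_mono (ENNReal.mul_ne_top ENNReal.ofReal_ne_top (measure_ne_top _ R)) hfinal
  rwa [toReal_enorm, Real.norm_eq_abs, ENNReal.toReal_mul, ENNReal.toReal_ofReal hε] at this

/-! ### Products of test functions with functions of the solution -/

lemma RegulatedOnJ.continuousOn_mul {k h : ℝ → ℝ} (hk : ContinuousOn k J) (hh : RegulatedOnJ h) :
    RegulatedOnJ fun s => k s * h s := by
  refine ⟨fun s hs => ?_, fun s hs => ?_⟩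
  · obtain ⟨l, hl⟩ := hh.1 s hs
    refine ⟨k s * l, Tendsto.mul ((hk s ⟨hs.1, hs.2.le⟩).mono_left ?_) hl⟩
    refine nhdsWithin_le_iff.2 ?_
    filter_upwards [Ioo_mem_nhdsGT hs.2] with r hr
    exact ⟨hs.1.trans hr.1.le, hr.2.le⟩
  · obtain ⟨l, hl⟩ := hh.2 s hs
    refine ⟨k s * l, Tendsto.mul ((hk s ⟨hs.1.le, hs.2⟩).mono_left ?_) hl⟩
    refine nhdsWithin_le_iff.2 ?_
    filter_upwards [Ioo_mem_nhdsLT hs.1] with r hr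
    exact ⟨hr.1.le, hr.2.le.trans hs.2⟩

lemma RegulatedOnJ.of_eq_zero {h : ℝ → ℝ} (hh : ∀ s ∈ J, h s = 0) : RegulatedOnJ h := by
  refine ⟨fun s hs => tendsto_nhds_of_eventually_const (c := 0) ?_,
    fun s hs => tendsto_nhds_of_eventually_const (c := 0) ?_⟩
  · filter_upwards [Ioo_mem_nhdsGT hs.2] with r hr
    exact hh r ⟨hs.1.trans hr.1.le, hr.2.le⟩
  · filter_upwards [Ioo_mem_nhdsLT hs.1] with r hr
    exact hh r ⟨hr.1.le, hr.2.le.trans hs.2⟩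

section

variable {E : Type*} [NormedAddCommGroup E] {Ω : Set ℝ} {x : DynFun E} {p q : ℝ} {D : Set E}
  {G : E → ℝ}

/-- This makes `g(x) φ` a legitimate argument for `v`, so that the derivative of a primitive can
replace `v` there. Nothing is known about `x` outside `[p, q]`, but there `φ` vanishes. -/
lemma IsTest.comp_mul {φ : DynFun ℝ} (hφ : IsTest p q φ) (hx : IsLocSBV Ω x) (hpq : Icc p q ⊆ Ω)
    (hD : ∀ t ∈ Icc p q, ∀ s ∈ J, x t s ∈ D) (hG : ContinuousOn G D) :
    IsTest p q fun t s => G (x t s) * φ t s where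
  regulated t := by
    by_cases ht : t ∈ Icc p q
    · exact (hφ.regulated t).continuousOn_mul
        (hG.comp (hx.continuousOn (hpq ht)) fun s hs => hD t ht s hs)
    · exact RegulatedOnJ.of_eq_zero fun s hs => by rw [hφ.support t ht s hs, mul_zero]
  rightLim t := by
    by_cases ht : t ∈ Ico p q
    · have htm : t ∈ Icc p q := ⟨ht.1, ht.2.le⟩
      obtain ⟨l, hl⟩ := hφ.rightLim t
      refine ⟨G (x t (1 / 2)) * l, Tendsto.mul ?_ hl⟩
      refine (hG _ (hD t htm _ half_mem_J)).tendsto.comp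
        (tendsto_nhdsWithin_iff.2 ⟨hx.rightLim t (hpq htm), ?_⟩)
      filter_upwards [prod_mem_prod (Ioo_mem_nhdsGT ht.2) (mem_principal_self J)] with z hz
      exact hD _ ⟨ht.1.trans hz.1.1.le, hz.1.2.le⟩ _ hz.2
    · refine ⟨0, hasRightLim_of_eventually ?_⟩
      rw [mem_Ico, not_and_or, not_le, not_lt] at ht
      rcases ht with h | h
      · filter_upwards [Ioo_mem_nhdsGT h] with r hr s hs
        rw [hφ.support r (fun h' => absurd h'.1 hr.2.not_ge) s hs, mul_zero]
      · filter_upwards [self_mem_nhdsWithin] with r (hr : t < r) s hs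
        rw [hφ.support r (fun h' => absurd h'.2 (h.trans_lt hr).not_ge) s hs, mul_zero]
  leftLim t := by
    by_cases ht : t ∈ Ioc p q
    · have htm : t ∈ Icc p q := ⟨ht.1.le, ht.2⟩
      obtain ⟨l, hl⟩ := hφ.leftLim t
      refine ⟨G (x t (-(1 / 2))) * l, Tendsto.mul ?_ hl⟩
      refine (hG _ (hD t htm _ neg_half_mem_J)).tendsto.comp
        (tendsto_nhdsWithin_iff.2 ⟨hx.leftLim t (hpq htm), ?_⟩)
      filter_upwards [prod_mem_prod (Ioo_mem_nhdsLT ht.1) (mem_principal_self J)] with z hz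
      exact hD _ ⟨hz.1.1.le, hz.1.2.le.trans ht.2⟩ _ hz.2
    · refine ⟨0, hasLeftLim_of_eventually ?_⟩
      rw [mem_Ioc, not_and_or, not_lt, not_le] at ht
      rcases ht with h | h
      · filter_upwards [self_mem_nhdsWithin] with r (hr : r < t) s hs
        rw [hφ.support r (fun h' => absurd h'.1 (hr.trans_le h).not_ge) s hs, mul_zero]
      · filter_upwards [Ioo_mem_nhdsLT h] with r hr s hs
        rw [hφ.support r (fun h' => absurd h'.2 hr.1.not_ge) s hs, mul_zero]
  support t ht s hs := by rw [hφ.support t ht s hs, mul_zero]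

lemma continuousAt_ord {t : ℝ} (ht : t ∉ discSet x) :
    ContinuousAt (ord x) t := by
  obtain ⟨-, hr, hl⟩ := not_not.1 ht
  exact continuousAt_iff_continuous_left'_right'.2
    ⟨hl.tendsto_apply zero_mem_J, hr.tendsto_apply zero_mem_J⟩

/-- Off the countable, hence null, set of discontinuities the ordinary part is continuous. -/
lemma IsLocSBV.aestronglyMeasurable_comp_ord (hx : IsLocSBV Ω x) (hpq : Icc p q ⊆ Ω)
    (hD : ∀ t ∈ Icc p q, ord x t ∈ D) (hG : ContinuousOn G D) :
    AEStronglyMeasurable (fun t => G (ord x t)) (volume.restrict (Icc p q)) := by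
  have hc := hx.countable_discSet hpq
  have he : (Icc p q \ (discSet x ∩ Icc p q) : Set ℝ) =ᵐ[volume] (Icc p q : Set ℝ) :=
    sdiff_null_ae_eq_self (hc.measure_zero _)
  rw [← Measure.restrict_congr_set he]
  refine ContinuousOn.aestronglyMeasurable ?_ (measurableSet_Icc.diff hc.measurableSet)
  refine hG.comp (fun t ht => (continuousAt_ord fun h => ht.2 ⟨h, ht.1⟩).continuousWithinAt)
    fun t ht => hD t ht.1

/-- Bounded variation keeps `x` within a bounded distance of its value at `p`, so the Lipschitz
function `G` stays bounded along it. -/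
lemma IsLocSBV.integrableOn_mul_comp_ord (hx : IsLocSBV Ω x) (hpq : Icc p q ⊆ Ω)
    (hD : ∀ t ∈ Icc p q, ord x t ∈ D) {K : NNReal} (hG : LipschitzOnWith K G D)
    {h : ℝ → ℝ} (hh : ContinuousOn h (Icc p q)) :
    IntegrableOn (fun t => h t * G (ord x t)) (Icc p q) := by
  rcases lt_or_ge q p with hqp | hle
  · simp [Icc_eq_empty_of_lt hqp]
  have hp : p ∈ Icc p q := ⟨le_rfl, hle⟩
  refine (hh.integrableOn_compact isCompact_Icc).mul_bdd
    (c := |G (ord x p)| + K * (eVariationOn (ord x) (Icc p q)).toReal)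
    (hx.aestronglyMeasurable_comp_ord hpq hD hG.continuousOn) ?_
  rw [ae_restrict_iff' measurableSet_Icc]
  refine Eventually.of_forall fun t ht => ?_
  have h1 := hG.dist_le_mul _ (hD t ht) _ (hD p hp)
  have h2 := (hx.boundedVariationOn_Icc hpq hle).dist_le ht hp
  have h3 : (K : ℝ) * dist (ord x t) (ord x p) ≤
      K * (eVariationOn (ord x) (Icc p q)).toReal := by gcongr
  rw [Real.dist_eq] at h1
  rw [Real.norm_eq_abs]
  have := abs_sub_abs_le_abs_sub (G (ord x t)) (G (ord x p))
  linarith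

lemma ord_dynIndicator (R : Set (ℝ × ℝ)) (t : ℝ) :
    ord (dynIndicator R) t = {t : ℝ | (t, (0 : ℝ)) ∈ R}.indicator 1 t := rfl

lemma integrable_mul_dynIndicator {R : Set (ℝ × ℝ)} (hR : MeasurableSet R)
    (hsupp : ∀ t, (t, (0 : ℝ)) ∈ R → t ∈ Icc p q) {h : ℝ → ℝ} (hh : IntegrableOn h (Icc p q)) :
    Integrable fun t => h t * ord (dynIndicator R) t := by
  have hS : MeasurableSet {t : ℝ | (t, (0 : ℝ)) ∈ R} :=
    (measurable_id.prodMk measurable_const) hR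
  have : (fun t => h t * ord (dynIndicator R) t) = {t : ℝ | (t, (0 : ℝ)) ∈ R}.indicator h := by
    funext t
    rw [ord_dynIndicator]
    by_cases ht : t ∈ {t : ℝ | (t, (0 : ℝ)) ∈ R} <;> simp [ht]
  rw [this, integrable_indicator_iff hS]
  exact hh.mono_set hsupp

lemma intervalIntegrable_mul_dynIndicator {R : Set (ℝ × ℝ)} (hR : MeasurableSet R) {k : ℝ → ℝ}
    (hk : ContinuousOn k J) (τ : ℝ) :
    IntervalIntegrable (fun s => k s * dynIndicator R τ s) volume (-(1 / 2)) (1 / 2) := by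
  rw [intervalIntegrable_iff_integrableOn_Icc_of_le (by norm_num)]
  have hS : MeasurableSet {s : ℝ | (τ, s) ∈ R} := (measurable_const.prodMk measurable_id) hR
  have : (fun s => k s * dynIndicator R τ s) = {s : ℝ | (τ, s) ∈ R}.indicator k := by
    funext s
    by_cases hs : (τ, s) ∈ R <;> simp [dynIndicator, hs]
  rw [this]
  exact (hk.integrableOn_compact isCompact_Icc).indicator hS

lemma deltaPair_congr {τ : ℝ} {α : ℝ → ℝ} {φ ψ : DynFun ℝ} (h : ∀ s ∈ J, φ τ s = ψ τ s) :
    deltaPair τ α φ = deltaPair τ α ψ := by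
  refine intervalIntegral.integral_congr fun s hs => ?_
  rw [uIcc_eq_J] at hs
  simp only [h s hs]

lemma mem_Icc_of_mem_region {a b s s' : ℝ} (ha : p ≤ a) (hab : a ≤ b) (hb : b ≤ q)
    {z : ℝ × ℝ} (hz : z ∈ region a b s s') : z.1 ∈ Icc p q := by
  rcases hz with ⟨h, -⟩ | ⟨h, -⟩
  · exact ⟨ha.trans h.1.le, h.2.le.trans hb⟩
  · rw [mem_singleton_iff] at h
    exact ⟨h ▸ ha.trans hab, h ▸ hb⟩

lemma deltaPair_sub_const_mul (hx : IsLocSBV Ω x) (hpq : Icc p q ⊆ Ω)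
    (hD : ∀ t ∈ Icc p q, ∀ s ∈ J, x t s ∈ D) (hG : ContinuousOn G D) {a b s s' : ℝ}
    (ha : p ≤ a) (hab : a ≤ b) (hb : b ≤ q) (c τ : ℝ) {α : ℝ → ℝ} (hα : ContinuousOn α J) :
    deltaPair τ α (fun t r => (G (x t r) - c) * dynIndicator (region a b s s') t r) =
      deltaPair τ α (fun t r => G (x t r) * dynIndicator (region a b s s') t r) -
        c * deltaPair τ α (dynIndicator (region a b s s')) := by
  have hR := measurableSet_region a b s s'
  by_cases hτ : τ ∈ Icc p q
  · have hGx : ContinuousOn (fun r => G (x τ r)) J :=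
      hG.comp (hx.continuousOn (hpq hτ)) fun r hr => hD τ hτ r hr
    rw [deltaPair, deltaPair, deltaPair, ← intervalIntegral.integral_const_mul,
      ← intervalIntegral.integral_sub]
    · congr 1
      funext r
      ring
    · simpa only [Pi.mul_apply, mul_assoc] using intervalIntegrable_mul_dynIndicator hR (hα.mul hGx) τ
    · exact (intervalIntegrable_mul_dynIndicator hR hα τ).const_mul c
  -- For `τ` outside `[p, q]` the value of `x` may be irregular, but all three pairings vanish with
  -- the indicator.
  · have h0 := (isTest_dynIndicator_region (s := s) (s' := s') ha hab hb).support τ hτ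
    have hz : deltaPair τ α 0 = 0 := by simp [deltaPair]
    rw [deltaPair_congr (ψ := 0), deltaPair_congr (φ := fun t r => G (x t r) * _) (ψ := 0),
      deltaPair_congr (φ := dynIndicator _) (ψ := 0), hz]
    · ring
    · exact fun r hr => h0 r hr
    · exact fun r hr => by simp [h0 r hr]
    · exact fun r hr => by simp [h0 r hr]

end

/-! ### Linearity and sign of the pairing with `v` -/

section Pairing

variable {n : ℕ} {Ω Ω' : Set ℝ} {x : DynFun (EuclideanSpace ℝ (Fin n))} {p q : ℝ}
  {D : Set (EuclideanSpace ℝ (Fin n))} {G : EuclideanSpace ℝ (Fin n) → ℝ} {v : Impulse n}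

lemma Impulse.Admissible.summable (hv : v.Admissible Ω') (hpq : Icc p q ⊆ Ω') {φ : DynFun ℝ}
    (hφ : IsTest p q φ) (j : Fin n) :
    Summable fun k => v.c k j * deltaPair (v.τ k) (fun s => v.α k s j) φ := by
  obtain ⟨u, -, hu⟩ := hv.primitive
  exact (hu p q hpq φ hφ j).summable

lemma Impulse.IsPrimitive.pair_eq {u : DynFun (EuclideanSpace ℝ (Fin n))}
    (hu : v.IsPrimitive Ω' u) (hpq : Icc p q ⊆ Ω') {φ : DynFun ℝ} (hφ : IsTest p q φ) (j : Fin n) :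
    v.pair j φ = derivPair p q (fun t s => u t s j) φ := by
  rw [Impulse.pair, (hu p q hpq φ hφ j).tsum_eq]
  ring

lemma continuousOn_coord {f : ℝ → EuclideanSpace ℝ (Fin n)} {S : Set ℝ} (hf : ContinuousOn f S)
    (j : Fin n) : ContinuousOn (fun t => f t j) S :=
  (EuclideanSpace.proj (𝕜 := ℝ) j).continuous.comp_continuousOn hf

/-- Splitting the infinite sum of delta-functions needs convergence on both test functions, which
the existence of a primitive supplies. -/
lemma Impulse.Admissible.pair_sub_const_mul (hv : v.Admissible Ω') (hpq' : Icc p q ⊆ Ω')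
    (hx : IsLocSBV Ω x) (hpq : Icc p q ⊆ Ω) (hD : ∀ t ∈ Icc p q, ∀ s ∈ J, x t s ∈ D)
    {K : NNReal} (hG : LipschitzOnWith K G D) {a b s s' : ℝ}
    (ha : p ≤ a) (hab : a ≤ b) (hb : b ≤ q) (c : ℝ) (j : Fin n) :
    v.pair j (fun t r => (G (x t r) - c) * dynIndicator (region a b s s') t r) =
      v.pair j (fun t r => G (x t r) * dynIndicator (region a b s s') t r) -
        c * v.pair j (dynIndicator (region a b s s')) := by
  have hφ := isTest_dynIndicator_region (s := s) (s' := s') ha hab hb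
  have hw : ContinuousOn (fun t => v.w t j) (Icc p q) :=
    continuousOn_coord (hv.continuous_w.mono hpq') j
  have hsupp : ∀ t, (t, (0 : ℝ)) ∈ region a b s s' → t ∈ Icc p q := fun t ht =>
    mem_Icc_of_mem_region ha hab hb ht
  have hR := measurableSet_region a b s s'
  have h1 : regularPair (fun t => v.w t j)
      (fun t r => (G (x t r) - c) * dynIndicator (region a b s s') t r) =
      regularPair (fun t => v.w t j) (fun t r => G (x t r) * dynIndicator (region a b s s') t r) -
        c * regularPair (fun t => v.w t j) (dynIndicator (region a b s s')) := by
    rw [regularPair, regularPair, regularPair, ← integral_const_mul, ← integral_sub]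
    · congr 1
      funext t
      simp only [ord]
      ring
    · have := integrable_mul_dynIndicator hR hsupp
        (hx.integrableOn_mul_comp_ord hpq (fun t ht => hD t ht 0 zero_mem_J) hG hw)
      simpa only [mul_assoc] using! this
    · exact (integrable_mul_dynIndicator hR hsupp
        (hw.integrableOn_compact isCompact_Icc)).const_mul c
  have h2 : ∀ k, v.c k j * deltaPair (v.τ k) (fun s => v.α k s j)
      (fun t r => (G (x t r) - c) * dynIndicator (region a b s s') t r) =
      v.c k j * deltaPair (v.τ k) (fun s => v.α k s j)
        (fun t r => G (x t r) * dynIndicator (region a b s s') t r) -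
      c * (v.c k j * deltaPair (v.τ k) (fun s => v.α k s j) (dynIndicator (region a b s s'))) := by
    intro k
    rw [deltaPair_sub_const_mul hx hpq hD hG.continuousOn ha hab hb c _
      (continuousOn_coord (hv.continuous_shape k) j)]
    ring
  rw [Impulse.pair, Impulse.pair, Impulse.pair, h1, tsum_congr h2,
    (hv.summable hpq' (hφ.comp_mul hx hpq hD hG.continuousOn) j).tsum_sub
      ((hv.summable hpq' hφ j).mul_left c), tsum_mul_left]
  ring

lemma regularPair_sub_const_mul (hx : IsLocSBV Ω x) (hpq : Icc p q ⊆ Ω)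
    (hD : ∀ t ∈ Icc p q, ∀ s ∈ J, x t s ∈ D) {K : NNReal} (hG : LipschitzOnWith K G D)
    {a b s s' : ℝ} (ha : p ≤ a) (hab : a ≤ b) (hb : b ≤ q) (c : ℝ) :
    regularPair (fun t => G (ord x t) - c) (dynIndicator (region a b s s')) =
      regularPair (fun t => G (ord x t)) (dynIndicator (region a b s s')) -
        c * regularPair (fun _ => 1) (dynIndicator (region a b s s')) := by
  have hsupp : ∀ t, (t, (0 : ℝ)) ∈ region a b s s' → t ∈ Icc p q := fun t ht =>
    mem_Icc_of_mem_region ha hab hb ht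
  have hR := measurableSet_region a b s s'
  rw [regularPair, regularPair, regularPair, ← integral_const_mul, ← integral_sub]
  · congr 1
    funext t
    ring
  · have := hx.integrableOn_mul_comp_ord hpq (fun t ht => hD t ht 0 zero_mem_J) hG
      (continuousOn_const (c := (1 : ℝ)))
    simp only [one_mul] at this
    exact integrable_mul_dynIndicator hR hsupp this
  · exact (integrable_mul_dynIndicator hR hsupp
      ((continuousOn_const (c := (1 : ℝ))).integrableOn_compact isCompact_Icc)).const_mul c

/-- If the vector `A` and the matrix row `B` satisfy the sign conditions, then the pairing of
`A + B v` with a dynamic indicator function is not positive. -/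
lemma Impulse.Admissible.frozen_pair_nonpos (hv : v.Admissible Ω') (hpq' : Icc p q ⊆ Ω')
    {a b s s' : ℝ} (ha : p ≤ a) (hab : a ≤ b) (hb : b ≤ q) {A : ℝ} {B : Fin n → ℝ}
    (h₁ : ∀ t > p, A + ∑ j, B j * v.w t j ≤ 0)
    (h₂ : ∀ k, ∀ r ∈ J, ∑ j, B j * (v.c k j * v.α k r j) ≤ 0) :
    A * regularPair (fun _ => 1) (dynIndicator (region a b s s')) +
      ∑ j, B j * v.pair j (dynIndicator (region a b s s')) ≤ 0 := by
  set χ := dynIndicator (region a b s s') with hχ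
  have hφ : IsTest p q χ := isTest_dynIndicator_region (s := s) (s' := s') ha hab hb
  have hsupp : ∀ t, (t, (0 : ℝ)) ∈ region a b s s' → t ∈ Icc p q := fun t ht =>
    mem_Icc_of_mem_region ha hab hb ht
  have hR := measurableSet_region a b s s'
  have hreg : A * regularPair (fun _ => 1) χ + ∑ j, B j * regularPair (fun t => v.w t j) χ ≤ 0 := by
    simp only [regularPair, ← integral_const_mul]
    have i1 : Integrable fun t => A * (1 * ord χ t) :=
      (integrable_mul_dynIndicator hR hsupp
        ((continuousOn_const (c := (1 : ℝ))).integrableOn_compact isCompact_Icc)).const_mul A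
    have i2 : ∀ j, Integrable fun t => B j * (v.w t j * ord χ t) := fun j =>
      (integrable_mul_dynIndicator hR hsupp
        ((continuousOn_coord (hv.continuous_w.mono hpq') j).integrableOn_compact
          isCompact_Icc)).const_mul (B j)
    rw [← integral_finsetSum _ fun j _ => i2 j, ← integral_add i1
      (integrable_finsetSum _ fun j _ => i2 j)]
    refine integral_nonpos_of_ae ?_
    -- The sign condition holds only for `t > p`; the point `p` is null for the regular part.
    have hne : ∀ᵐ t : ℝ, t ≠ p := by simp [ae_iff, measure_singleton]
    filter_upwards [hne] with t ht
    have heq : A * (1 * ord χ t) + ∑ j, B j * (v.w t j * ord χ t) =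
        (A + ∑ j, B j * v.w t j) * ord χ t := by
      rw [add_mul, Finset.sum_mul, one_mul]
      simp only [mul_assoc]
    rw [heq]
    rcases lt_or_gt_of_ne ht with htp | htp
    · rw [ord, hφ.support t (fun h => absurd h.1 htp.not_ge) 0 zero_mem_J, mul_zero]
      exact le_rfl
    · exact mul_nonpos_of_nonpos_of_nonneg (h₁ t htp) (dynIndicator_nonneg _ _ _)
  have hdelta : ∑ j, B j * ∑' k, v.c k j * deltaPair (v.τ k) (fun s => v.α k s j) χ ≤ 0 := by
    simp only [← tsum_mul_left]
    rw [← Summable.tsum_finsetSum fun j _ => (hv.summable hpq' hφ j).mul_left (B j)]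
    refine tsum_nonpos fun k => ?_
    have i3 : ∀ j, IntervalIntegrable (fun r => B j * (v.c k j * (v.α k r j * χ (v.τ k) r)))
        volume (-(1 / 2)) (1 / 2) := fun j =>
      ((intervalIntegrable_mul_dynIndicator hR (continuousOn_coord (hv.continuous_shape k) j)
        _).const_mul _).const_mul _
    simp only [deltaPair, ← intervalIntegral.integral_const_mul]
    rw [← intervalIntegral.integral_finsetSum fun j _ => i3 j, ← neg_nonneg,
      ← intervalIntegral.integral_neg]
    refine intervalIntegral.integral_nonneg (by norm_num) fun r hr => ?_
    have heq : ∑ j, B j * (v.c k j * (v.α k r j * χ (v.τ k) r)) =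
        (∑ j, B j * (v.c k j * v.α k r j)) * χ (v.τ k) r := by
      rw [Finset.sum_mul]
      simp only [mul_assoc]
    rw [heq, neg_nonneg]
    exact mul_nonpos_of_nonpos_of_nonneg (h₂ k r hr) (dynIndicator_nonneg _ _ _)
  simp only [Impulse.pair, mul_add, Finset.sum_add_distrib]
  linarith

end Pairing

/-! ### Increments with frozen coefficients -/

/-- The measure is Lebesgue measure on `[p, q]` carried by the line `s = 0`, where the ordinary part
is evaluated. -/
lemma exists_measure_regularPair (p q : ℝ) :
    ∃ m : Measure (ℝ × ℝ), IsFiniteMeasure m ∧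
      ∀ (h : ℝ → ℝ) (a b s s' ε : ℝ), p ≤ a → a ≤ b → b ≤ q → 0 ≤ ε →
        (∀ t, (t, (0 : ℝ)) ∈ region a b s s' → |h t| ≤ ε) →
        |regularPair h (dynIndicator (region a b s s'))| ≤ ε * m.real (region a b s s') := by
  refine ⟨(volume.restrict (Icc p q)).map fun t => (t, (0 : ℝ)), inferInstance, ?_⟩
  intro h a b s s' ε ha hab hb hε hh
  have hm : Measurable fun t : ℝ => (t, (0 : ℝ)) := measurable_id.prodMk measurable_const
  have hR := measurableSet_region a b s s'
  set S : Set ℝ := (fun t : ℝ => (t, (0 : ℝ))) ⁻¹' region a b s s' with hS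
  have hSm : MeasurableSet S := hm hR
  have hSI : S ⊆ Icc p q := fun t ht => mem_Icc_of_mem_region ha hab hb ht
  have hval : ((volume.restrict (Icc p q)).map fun t => (t, (0 : ℝ))).real (region a b s s') =
      volume.real S := by
    rw [measureReal_def, Measure.map_apply hm hR, Measure.restrict_apply hSm,
      inter_eq_left.2 hSI, measureReal_def]
  have hfin : volume S ≠ ⊤ := measure_ne_top_of_subset hSI (by simp)
  rw [hval, ← Real.norm_eq_abs, regularPair]
  refine (norm_integral_le_of_norm_le (g := S.indicator fun _ => ε) ?_
    (Eventually.of_forall fun t => ?_)).trans_eq ?_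
  · rw [integrable_indicator_iff hSm]
    exact integrableOn_const hfin
  · rw [ord_dynIndicator]
    by_cases ht : t ∈ S
    · rw [indicator_of_mem ht, indicator_of_mem (by exact ht)]
      simpa using hh t ht
    · rw [indicator_of_notMem ht, indicator_of_notMem (by exact ht)]
      simp
  · rw [integral_indicator hSm, setIntegral_const, smul_eq_mul, mul_comm]

/-- The distance to the closed ball of radius `r` around `xs`. -/
def excess {n : ℕ} (xs : EuclideanSpace ℝ (Fin n)) (r : ℝ) (x : EuclideanSpace ℝ (Fin n)) : ℝ :=
  max (‖x - xs‖ - r) 0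

section

variable {n : ℕ} {Ω Ω' : Set ℝ} {x : DynFun (EuclideanSpace ℝ (Fin n))} {p q r : ℝ}
  {D : Set (EuclideanSpace ℝ (Fin n))} {v : Impulse n}
  {f : EuclideanSpace ℝ (Fin n) → EuclideanSpace ℝ (Fin n)}
  {g : EuclideanSpace ℝ (Fin n) → Matrix (Fin n) (Fin n) ℝ}
  {xs : EuclideanSpace ℝ (Fin n)}

lemma excess_nonneg (y : EuclideanSpace ℝ (Fin n)) : 0 ≤ excess xs r y := le_max_right _ _

lemma excess_le_add (y z : EuclideanSpace ℝ (Fin n)) :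
    excess xs r y ≤ excess xs r z + ‖y - z‖ := by
  have h1 : ‖y - xs‖ ≤ ‖z - xs‖ + ‖y - z‖ := by
    calc ‖y - xs‖ = ‖(z - xs) + (y - z)‖ := by congr 1; abel
      _ ≤ _ := norm_add_le _ _
  have h2 : ‖z - xs‖ - r ≤ excess xs r z := le_max_left _ _
  refine max_le (by linarith) (add_nonneg (excess_nonneg z) (norm_nonneg _))

/-- Freezing the coefficients at a point `z`: the increment of the solution in the direction `e` over
a part of the time domain is bounded by its contents with respect to some finite measure times the
distance of the solution from `z`. -/
lemma IsSolution.exists_measure_increment (hv : v.Admissible Ω') (hx : IsSolution D f g v Ω x)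
    (hpq' : Icc p q ⊆ Ω') (hpq : Icc p q ⊆ Ω) (h : p ≤ q)
    (hf : ∃ K, LipschitzOnWith K f D)
    (hg : ∀ i j, ∃ K, LipschitzOnWith K (fun x => g x i j) D) :
    ∃ (m : Measure (ℝ × ℝ)) (C : ℝ), IsFiniteMeasure m ∧ 0 ≤ C ∧
      ∀ (a b s s' δ : ℝ) (e z : EuclideanSpace ℝ (Fin n)), p ≤ a → a ≤ b → b ≤ q → 0 ≤ δ →
        ‖e‖ ≤ 1 → z ∈ D →
        (∀ t, ∀ σ ∈ J, (t, σ) ∈ region a b s s' → ‖x t σ - z‖ ≤ δ) →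
        (∀ t > p, inner ℝ e (f z + mulV (g z) (v.w t)) ≤ 0) →
        (∀ k, ∀ σ ∈ J, inner ℝ e (mulV (g z) (cmul (v.c k) (v.α k σ))) ≤ 0) →
        ∑ i, e i * derivPair p q (fun t s => x t s i) (dynIndicator (region a b s s')) ≤
          C * δ * m.real (region a b s s') := by
  obtain ⟨Kf, hKf⟩ := hf
  choose Kg hKg using hg
  obtain ⟨u, hu, hprim⟩ := hv.primitive
  obtain ⟨m₀, hm₀, hbound₀⟩ := exists_measure_regularPair p q
  -- On test functions `v` acts as the derivative of its primitive `u`, whose dominating measures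
  -- control the errors in the terms with `g`.
  choose m₁ hm₁ hbound₁ using fun j => (hu.coord j).exists_measure hpq' h
  set C : ℝ := Kf + ∑ i, ∑ j, (Kg i j : ℝ) with hC
  have hKC : ∀ i j, (Kg i j : ℝ) ≤ C := fun i j => by
    have h1 : (Kg i j : ℝ) ≤ ∑ j, (Kg i j : ℝ) :=
      Finset.single_le_sum (f := fun j => (Kg i j : ℝ)) (fun _ _ => NNReal.coe_nonneg _)
        (Finset.mem_univ j)
    have h2 : ∑ j, (Kg i j : ℝ) ≤ ∑ i, ∑ j, (Kg i j : ℝ) :=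
      Finset.single_le_sum (f := fun i => ∑ j, (Kg i j : ℝ))
        (fun _ _ => Finset.sum_nonneg fun _ _ => NNReal.coe_nonneg _) (Finset.mem_univ i)
    have := Kf.coe_nonneg
    linarith
  have hfC : (Kf : ℝ) ≤ C := by
    have : 0 ≤ ∑ i, ∑ j, (Kg i j : ℝ) :=
      Finset.sum_nonneg fun _ _ => Finset.sum_nonneg fun _ _ => NNReal.coe_nonneg _
    linarith
  have hC0 : 0 ≤ C := Kf.coe_nonneg.trans hfC
  -- The factor `n` comes from adding the same error bound over all coordinates `i`.
  refine ⟨m₀ + ∑ j, m₁ j, n * C, inferInstance, by positivity, ?_⟩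
  intro a b s s' δ e z ha hab hb hδ he hz hosc hin₁ hin₂
  set R := region a b s s' with hR
  set χ := dynIndicator R with hχ
  have hRm : MeasurableSet R := measurableSet_region a b s s'
  have hφ : IsTest p q χ := isTest_dynIndicator_region (s := s) (s' := s') ha hab hb
  have hD : ∀ t ∈ Icc p q, ∀ s ∈ J, x t s ∈ D := fun t ht s hs => hx.mem t (hpq ht) s hs
  have hfi : ∀ i, LipschitzOnWith Kf (fun y => f y i) D := fun i =>
    LipschitzOnWith.of_dist_le_mul fun y hy y' hy' => by
      refine le_trans ?_ (hKf.dist_le_mul y hy y' hy')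
      simpa [dist_eq_norm] using PiLp.norm_apply_le (f y - f y') i
  have hdist : ∀ t, ∀ σ ∈ J, (t, σ) ∈ R → dist (x t σ) z ≤ δ := fun t σ hσ ht => by
    rw [dist_eq_norm]
    exact hosc t σ hσ ht
  -- the error terms
  have herr₀ : ∀ i, |regularPair (fun t => f (ord x t) i - f z i) χ| ≤ C * δ * m₀.real R := by
    intro i
    refine hbound₀ _ a b s s' _ ha hab hb (by positivity) fun t ht => ?_
    have h1 := (hfi i).dist_le_mul _ (hD t (mem_Icc_of_mem_region ha hab hb ht) 0 zero_mem_J) z hz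
    rw [Real.dist_eq] at h1
    exact h1.trans (mul_le_mul hfC (hdist t 0 zero_mem_J ht) dist_nonneg hC0)
  have herr₁ : ∀ i j, |v.pair j (fun t r => (g (x t r) i j - g z i j) * χ t r)| ≤
      C * δ * (m₁ j).real R := by
    intro i j
    have htest : IsTest p q fun t r => (g (x t r) i j - g z i j) * χ t r :=
      hφ.comp_mul (G := fun y => g y i j - g z i j) hx.sbv hpq hD
        ((hKg i j).continuousOn.sub continuousOn_const)
    rw [hprim.pair_eq hpq' htest]
    refine hbound₁ j _ R _ hRm (by positivity) fun t ht σ hσ => ?_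
    rw [abs_mul, abs_of_nonneg (dynIndicator_nonneg R t σ)]
    by_cases hmem : (t, σ) ∈ R
    · refine mul_le_mul_of_nonneg_right ?_ (dynIndicator_nonneg R t σ)
      have h1 := (hKg i j).dist_le_mul _ (hD t ht σ hσ) z hz
      rw [Real.dist_eq] at h1
      exact h1.trans (mul_le_mul (hKC i j) (hdist t σ hσ hmem) dist_nonneg hC0)
    · simp [dynIndicator, hmem]
  -- the decomposition
  have hdec : ∀ i, derivPair p q (fun t s => x t s i) χ =
      (f z i * regularPair (fun _ => 1) χ + ∑ j, g z i j * v.pair j χ) +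
      (regularPair (fun t => f (ord x t) i - f z i) χ +
        ∑ j, v.pair j (fun t r => (g (x t r) i j - g z i j) * χ t r)) := by
    intro i
    have h1 := regularPair_sub_const_mul (s := s) (s' := s') hx.sbv hpq hD (hfi i) ha hab hb (f z i)
    have h2 := fun j => hv.pair_sub_const_mul (s := s) (s' := s') hpq' hx.sbv hpq hD (hKg i j)
      ha hab hb (g z i j) j
    rw [hx.eqn p q hpq χ hφ i, h1, Finset.sum_congr rfl fun j _ => h2 j, Finset.sum_sub_distrib]
    ring
  have hei : ∀ i, |e i| ≤ 1 := fun i => (PiLp.norm_apply_le e i).trans he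
  have hfrozen : ∑ i, e i * (f z i * regularPair (fun _ => 1) χ + ∑ j, g z i j * v.pair j χ) ≤ 0 := by
    have hmul : ∀ y : EuclideanSpace ℝ (Fin n),
        inner ℝ e (mulV (g z) y) = ∑ j, (∑ i, e i * g z i j) * y j := by
      intro y
      simp only [PiLp.inner_apply, mulV, Matrix.mulVec, dotProduct, Finset.sum_mul]
      rw [Finset.sum_comm]
      refine Finset.sum_congr rfl fun i _ => ?_
      simp [Finset.sum_mul]
      refine Finset.sum_congr rfl fun j _ => ?_
      ring
    have hfe : inner ℝ e (f z) = ∑ i, e i * f z i := by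
      simp [PiLp.inner_apply, mul_comm]
    have := hv.frozen_pair_nonpos (s := s) (s' := s') hpq' ha hab hb (A := ∑ i, e i * f z i)
      (B := fun j => ∑ i, e i * g z i j)
      (fun t ht => by
        have := hin₁ t ht
        rwa [inner_add_right, hmul, hfe] at this)
      (fun k σ hσ => by
        have := hin₂ k σ hσ
        rw [hmul] at this
        simpa [cmul] using this)
    refine le_of_eq_of_le ?_ this
    simp only [mul_add, Finset.sum_add_distrib, Finset.sum_mul, Finset.mul_sum, ← mul_assoc]
    congr 1
    rw [Finset.sum_comm]
  have herror : ∀ i, e i * (regularPair (fun t => f (ord x t) i - f z i) χ +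
      ∑ j, v.pair j (fun t r => (g (x t r) i j - g z i j) * χ t r)) ≤
      C * δ * (m₀ + ∑ j, m₁ j).real R := by
    intro i
    have hreal : (m₀ + ∑ j, m₁ j).real R = m₀.real R + ∑ j, (m₁ j).real R := by
      rw [measureReal_add_apply, measureReal_def (μ := ∑ j, m₁ j), Measure.finsetSum_apply,
        ENNReal.toReal_sum fun j _ => measure_ne_top _ _]
      rfl
    refine (le_abs_self _).trans ?_
    rw [abs_mul, hreal, mul_add (C * δ), Finset.mul_sum]
    refine (mul_le_of_le_one_left (abs_nonneg _) (hei i)).trans ?_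
    refine (abs_add_le _ _).trans (add_le_add (herr₀ i) ?_)
    exact (Finset.abs_sum_le_sum_abs _ _).trans (Finset.sum_le_sum fun j _ => herr₁ i j)
  calc _ = _ + _ := by
        rw [← Finset.sum_add_distrib]
        refine Finset.sum_congr rfl fun i _ => ?_
        rw [hdec i, mul_add]
    _ ≤ 0 + ∑ i : Fin n, C * δ * (m₀ + ∑ j, m₁ j).real R :=
        add_le_add hfrozen (Finset.sum_le_sum fun i _ => herror i)
    _ = _ := by
        rw [Finset.sum_const, Finset.card_univ, Fintype.card_fin, nsmul_eq_mul]
        ring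

end

/-! ### Propagation along the lexicographic order and invariance of balls -/

/-- The set of pairs `(t', s')` that precede `(t, s)` in the lexicographic order. -/
def lexIic (t s : ℝ) : Set (ℝ × ℝ) := Iio t ×ˢ univ ∪ {t} ×ˢ Iic s

/-- The region lies strictly after `(a, s₀)` and not beyond `(b, s')`. This additivity lets the
exponential factors of successive steps multiply. -/
lemma measureReal_lexIic_add_region_le (m : Measure (ℝ × ℝ)) [IsFiniteMeasure m] {a b s₀ s s' : ℝ}
    (h : a < b ∨ a = b ∧ s₀ ≤ s) (hss' : s ≤ s') :
    m.real (lexIic a s₀) + m.real (region a b s s') ≤ m.real (lexIic b s') := by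
  rw [← measureReal_union ?_ (measurableSet_region a b s s')]
  · refine measureReal_mono ?_
    rintro ⟨t, σ⟩ ht
    simp only [lexIic, region, mem_union, mem_prod, mem_Iio, mem_univ, and_true,
      mem_singleton_iff, mem_Iic, mem_Ioo, mem_Ioc] at ht ⊢
    grind
  · rw [disjoint_left]
    rintro ⟨t, σ⟩ ht
    simp only [lexIic, region, mem_union, mem_prod, mem_Iio, mem_univ, and_true,
      mem_singleton_iff, mem_Iic, mem_Ioo, mem_Ioc] at ht ⊢
    grind

section

variable {n : ℕ} {Ω Ω' : Set ℝ} {x : DynFun (EuclideanSpace ℝ (Fin n))} {p q r : ℝ}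
  {D : Set (EuclideanSpace ℝ (Fin n))} {v : Impulse n}
  {f : EuclideanSpace ℝ (Fin n) → EuclideanSpace ℝ (Fin n)}
  {g : EuclideanSpace ℝ (Fin n) → Matrix (Fin n) (Fin n) ℝ}
  {xs : EuclideanSpace ℝ (Fin n)}

/-- Under the tangency conditions on the sphere of radius `r`, the distance to the ball grows at most
exponentially with respect to some finite measure, on parts of the time domain on which the solution
oscillates little. -/
lemma IsSolution.exists_measure_excess (hv : v.Admissible Ω') (hx : IsSolution D f g v Ω x)
    (hpq' : Icc p q ⊆ Ω') (hpq : Icc p q ⊆ Ω) (h : p ≤ q)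
    (hf : ∃ K, LipschitzOnWith K f D)
    (hg : ∀ i j, ∃ K, LipschitzOnWith K (fun x => g x i j) D)
    (hr : 0 < r) (hball : Metric.closedBall xs r ⊆ D)
    (h₁ : ∀ t > p, ∀ z, ‖z - xs‖ = r → inner ℝ (z - xs) (f z + mulV (g z) (v.w t)) ≤ 0)
    (h₂ : ∀ s ∈ J, ∀ k, ∀ z, ‖z - xs‖ = r →
      inner ℝ (z - xs) (mulV (g z) (cmul (v.c k) (v.α k s))) ≤ 0) :
    ∃ (m : Measure (ℝ × ℝ)) (C : ℝ), IsFiniteMeasure m ∧ 0 ≤ C ∧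
      ∀ (a b s s' η : ℝ) (X X' : EuclideanSpace ℝ (Fin n)), p ≤ a → a ≤ b → b ≤ q → 0 ≤ η →
        (∀ i, derivPair p q (fun t s => x t s i) (dynIndicator (region a b s s')) = X' i - X i) →
        (∀ t, ∀ σ ∈ J, (t, σ) ∈ region a b s s' → ‖x t σ - X'‖ ≤ η) → ‖X' - X‖ ≤ η →
        excess xs r X' + 2 * η ≤
          (excess xs r X + 2 * η) * Real.exp (C * m.real (region a b s s')) := by
  obtain ⟨m, C, hm, hC, hbound⟩ := hx.exists_measure_increment hv hpq' hpq h hf hg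
  refine ⟨m, C, hm, hC, ?_⟩
  intro a b s s' η X X' ha hab hb hη hinc hosc hXX'
  set μ := m.real (region a b s s') with hμ
  have hμ0 : 0 ≤ μ := measureReal_nonneg
  have hX0 : 0 ≤ excess xs r X := excess_nonneg X
  -- With `2 * η` added on both sides the linear estimate becomes multiplicative, and `1 + u ≤ exp
  -- u` finishes.
  suffices hlin : excess xs r X' ≤ excess xs r X + C * (excess xs r X + 2 * η) * μ by
    have hexp := Real.add_one_le_exp (C * μ)
    calc excess xs r X' + 2 * η ≤ (excess xs r X + 2 * η) * (C * μ + 1) := by linarith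
      _ ≤ _ := by gcongr
  rcases le_or_gt (‖X' - xs‖) r with hle | hlt
  · have : excess xs r X' = 0 := max_eq_right (sub_nonpos.2 hle)
    rw [this]
    positivity
  have hpos : 0 < ‖X' - xs‖ := hr.trans hlt
  set e : EuclideanSpace ℝ (Fin n) := ‖X' - xs‖⁻¹ • (X' - xs) with he
  have hen : ‖e‖ = 1 := by
    rw [he, norm_smul, norm_inv, norm_norm, inv_mul_cancel₀ hpos.ne']
  have heX : ‖X' - xs‖ • e = X' - xs := by
    rw [he, smul_smul, mul_inv_cancel₀ hpos.ne', one_smul]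
  -- The nearest point of the ball to `X'`; `e` is the outer unit normal there, so the tangency
  -- conditions at `z` are sign conditions in the direction `e`.
  set z := xs + r • e with hz
  have hzxs : z - xs = r • e := by rw [hz]; abel
  have hzn : ‖z - xs‖ = r := by
    rw [hzxs, norm_smul, hen, mul_one, Real.norm_of_nonneg hr.le]
  have hex : excess xs r X' = ‖X' - xs‖ - r := max_eq_left (sub_nonneg.2 hlt.le)
  have hXz : ‖X' - z‖ = excess xs r X' := by
    have : X' - z = (‖X' - xs‖ - r) • e := by
      rw [sub_smul, heX, hz]
      abel
    rw [this, norm_smul, hen, mul_one, hex, Real.norm_of_nonneg (sub_nonneg.2 hlt.le)]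
  have hsign : ∀ y : EuclideanSpace ℝ (Fin n), inner ℝ (z - xs) y ≤ 0 → inner ℝ e y ≤ 0 := by
    intro y hy
    rw [hzxs, inner_smul_left] at hy
    exact nonpos_of_mul_nonpos_right hy (by simpa using hr)
  have hgrow := excess_le_add (xs := xs) (r := r) X' X
  -- The distance to `z` is at most `η` plus the excess of `X'`, which exceeds that of `X` by at
  -- most `η`. The bound thus involves only the initial excess.
  have hmain := hbound a b s s' (excess xs r X + 2 * η) e z ha hab hb (by positivity) hen.le
    (hball (by rw [mem_closedBall_iff_norm, hzn]))
    (fun t σ hσ ht => by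
      have h3 : ‖x t σ - z‖ ≤ ‖x t σ - X'‖ + ‖X' - z‖ := norm_sub_le_norm_sub_add_norm_sub _ _ _
      have := hosc t σ hσ ht
      linarith)
    (fun t ht => hsign _ (h₁ t ht z hzn)) (fun k σ hσ => hsign _ (h₂ σ hσ k z hzn))
  have hsum : ∑ i, e i * derivPair p q (fun t s => x t s i) (dynIndicator (region a b s s')) =
      inner ℝ e (X' - X) := by
    simp only [hinc, PiLp.inner_apply]
    refine Finset.sum_congr rfl fun i _ => ?_
    simp [mul_comm]
  rw [hsum] at hmain
  -- The projection on `e` is exact at `X'` and at most the norm at `X`, so the growth of the excess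
  -- is bounded by the projected increment.
  have hi1 : inner ℝ e (X' - xs) = ‖X' - xs‖ := by
    conv_lhs => rw [← heX]
    rw [inner_smul_right, real_inner_self_eq_norm_sq, hen]
    ring
  have hi2 : inner ℝ e (X - xs) ≤ ‖X - xs‖ := by
    have := real_inner_le_norm e (X - xs)
    rwa [hen, one_mul] at this
  have hi3 : inner ℝ e (X' - X) = inner ℝ e (X' - xs) - inner ℝ e (X - xs) := by
    rw [← inner_sub_right]
    congr 1
    abel
  have hi4 : ‖X - xs‖ - r ≤ excess xs r X := le_max_left _ _
  linarith

/-- A closed ball in `D` with the tangency conditions on its boundary is positively invariant. -/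
theorem IsSolution.mem_closedBall (hv : v.Admissible Ω') (hx : IsSolution D f g v Ω x)
    (hpq' : Icc p q ⊆ Ω') (hpq : Icc p q ⊆ Ω) (h : p ≤ q)
    (hf : ∃ K, LipschitzOnWith K f D)
    (hg : ∀ i j, ∃ K, LipschitzOnWith K (fun x => g x i j) D)
    (hr : 0 < r) (hball : Metric.closedBall xs r ⊆ D)
    (h₁ : ∀ t > p, ∀ z, ‖z - xs‖ = r → inner ℝ (z - xs) (f z + mulV (g z) (v.w t)) ≤ 0)
    (h₂ : ∀ s ∈ J, ∀ k, ∀ z, ‖z - xs‖ = r →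
      inner ℝ (z - xs) (mulV (g z) (cmul (v.c k) (v.α k s))) ≤ 0)
    (h₀ : x p (-(1 / 2)) ∈ Metric.closedBall xs r) {s : ℝ} (hs : s ∈ J) :
    x q s ∈ Metric.closedBall xs r := by
  obtain ⟨m, C, hm, hC, hstep⟩ :=
    hx.exists_measure_excess hv hpq' hpq h hf hg hr hball h₁ h₂
  have key : ∀ η > 0, ∀ t ∈ Icc p q, ∀ s ∈ J,
      excess xs r (x t s) + 2 * η ≤ 2 * η * Real.exp (C * m.real (lexIic t s)) := by
    intro η hη
    set Good : ℝ → ℝ → Prop := fun t s =>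
      excess xs r (x t s) + 2 * η ≤ 2 * η * Real.exp (C * m.real (lexIic t s)) with hGood
    have hprop : ∀ a b s₀ s s' : ℝ, p ≤ a → a ≤ b → b ≤ q → (a < b ∨ a = b ∧ s₀ ≤ s) → s ≤ s' →
        (∀ i, derivPair p q (fun t s => x t s i) (dynIndicator (region a b s s')) =
          x b s' i - x a s₀ i) →
        (∀ t, ∀ σ ∈ J, (t, σ) ∈ region a b s s' → ‖x t σ - x b s'‖ ≤ η) →
        ‖x b s' - x a s₀‖ ≤ η → Good a s₀ → Good b s' := by
      intro a b s₀ s s' ha hab hb hlex hss' hinc hosc hdist hgood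
      have h1 := hstep a b s s' η _ _ ha hab hb hη.le hinc hosc hdist
      have h2 := measureReal_lexIic_add_region_le m hlex hss'
      calc excess xs r (x b s') + 2 * η
          ≤ (excess xs r (x a s₀) + 2 * η) * Real.exp (C * m.real (region a b s s')) := h1
        _ ≤ (2 * η * Real.exp (C * m.real (lexIic a s₀))) *
            Real.exp (C * m.real (region a b s s')) := by gcongr
        _ = 2 * η * Real.exp (C * (m.real (lexIic a s₀) + m.real (region a b s s'))) := by
            rw [mul_assoc, ← Real.exp_add, mul_add]
        _ ≤ _ := by gcongr
    have hmove : ∀ a b s', p ≤ a → a < b → b ≤ q → s' ∈ J →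
        (∀ t ∈ Ioo a b, ∀ σ ∈ J, ‖x t σ - x b s'‖ ≤ η) →
        (∀ σ ∈ J, σ ≤ s' → ‖x b σ - x b s'‖ ≤ η) →
        ‖x b s' - x a (1 / 2)‖ ≤ η → Good a (1 / 2) → Good b s' := by
      intro a b s' ha hab hb hs' hosc hosc' hdist
      refine hprop a b (1 / 2) (-(1 / 2)) s' ha hab.le hb (Or.inl hab) hs'.1
        (fun i => derivPair_region (hx.sbv.coord i) hpq ha hab hb hs') ?_ hdist
      rintro t σ hσ (⟨ht, -⟩ | ⟨ht, ht'⟩)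
      · exact hosc t ht σ hσ
      · obtain rfl : t = b := ht
        exact hosc' σ hσ ht'.2
    -- Within one fibre, uniform continuity in `s` allows finitely many steps of length `δ / 2`, on
    -- each of which the oscillation is below `η`.
    have hjump : ∀ t ∈ Icc p q, Good t (-(1 / 2)) → ∀ s ∈ J, Good t s := by
      intro t ht h0
      have huc : UniformContinuousOn (x t) J :=
        isCompact_Icc.uniformContinuousOn_of_continuous (hx.sbv.continuousOn (hpq ht))
      obtain ⟨δ, hδ, hdist⟩ := Metric.uniformContinuousOn_iff.1 huc η hη
      have hind : ∀ N : ℕ, ∀ s ∈ J, s ≤ -(1 / 2) + N * (δ / 2) → Good t s := by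
        intro N
        induction N with
        | zero =>
          intro s hs hle
          have : s = -(1 / 2) := le_antisymm (by simpa using hle) hs.1
          rwa [this]
        | succ N ih =>
          intro s hs hle
          push_cast at hle
          set s₀ := max (-(1 / 2)) (s - δ / 2) with hs₀
          have hs₀s : s₀ ≤ s := max_le hs.1 (by linarith)
          have hs₀J : s₀ ∈ J := ⟨le_max_left _ _, hs₀s.trans hs.2⟩
          have hs₀' : s - δ / 2 ≤ s₀ := le_max_right _ _
          have hN : 0 ≤ (N : ℝ) * (δ / 2) := by positivity
          have hgood : Good t s₀ := ih s₀ hs₀J (max_le (by linarith) (by linarith))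
          have hclose : ∀ σ ∈ J, s₀ ≤ σ → σ ≤ s → ‖x t σ - x t s‖ ≤ η := by
            intro σ hσ h3 h4
            rw [← dist_eq_norm]
            refine (hdist σ hσ s hs ?_).le
            rw [Real.dist_eq, abs_lt]
            constructor <;> linarith
          refine hprop t t s₀ s₀ s ht.1 le_rfl ht.2 (Or.inr ⟨rfl, le_rfl⟩) hs₀s
            (fun i => derivPair_region_self (hx.sbv.coord i) hpq ht hs₀J hs hs₀s) ?_ ?_ hgood
          · rintro t' σ hσ (⟨ht', -⟩ | ⟨ht', h3⟩)
            · exact absurd (ht'.1.trans ht'.2) (lt_irrefl _)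
            · obtain rfl : t' = t := ht'
              exact hclose σ hσ h3.1.le h3.2
          · rw [norm_sub_rev]
            exact hclose s₀ hs₀J le_rfl hs₀s
      intro s hs
      obtain ⟨N, hN⟩ := exists_nat_gt ((s + 1 / 2) / (δ / 2))
      rw [div_lt_iff₀ (by positivity)] at hN
      exact hind N s hs (by linarith)
    have hpp : p ∈ Icc p q := ⟨le_rfl, h⟩
    have hinit : Good p (-(1 / 2)) := by
      have h3 : excess xs r (x p (-(1 / 2))) = 0 :=
        max_eq_right (sub_nonpos.2 (mem_closedBall_iff_norm.1 h₀))
      have h4 : 1 ≤ Real.exp (C * m.real (lexIic p (-(1 / 2)))) :=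
        Real.one_le_exp (mul_nonneg hC measureReal_nonneg)
      simp only [hGood, h3, zero_add]
      nlinarith
    -- Continuous induction in `t`: left limits make the set closed, right limits let it be
    -- extended.
    set S : Set ℝ := {t | ∀ u ∈ Icc p t, ∀ s ∈ J, Good u s} with hS
    have hpS : p ∈ S := by
      intro u hu s hs
      obtain rfl : u = p := le_antisymm hu.2 hu.1
      exact hjump u hpp hinit s hs
    have hsub : Icc p q ⊆ S := by
      refine IsClosed.Icc_subset_of_forall_exists_gt ?_ hpS ?_
      · refine isClosed_of_closure_subset fun t ht => ?_
        have htI : t ∈ Icc p q :=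
          closure_minimal inter_subset_right isClosed_Icc ht
        have hbelow : ∀ u ∈ Ico p t, ∀ s ∈ J, Good u s := by
          intro u hu s hs
          obtain ⟨w, hw, hwS, -⟩ := mem_closure_iff.1 ht (Ioi u) isOpen_Ioi hu.2
          exact hwS u ⟨hu.1, le_of_lt hw⟩ s hs
        refine ⟨fun u hu s hs => ?_, htI⟩
        rcases hu.2.lt_or_eq with hlt | rfl
        · exact hbelow u ⟨hu.1, hlt⟩ s hs
        rcases hu.1.eq_or_lt with rfl | hlt
        · exact hpS _ ⟨le_rfl, le_rfl⟩ s hs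
        -- It suffices to reach the left limit at `u`, from a point `a` so close that the solution
        -- stays within `η` of that limit; the fibre over `u` is then climbed separately.
        refine hjump u htI ?_ s hs
        have hev := (hx.sbv.leftLim u (hpq htI)).eventually (Metric.closedBall_mem_nhds _ hη)
        rw [eventually_prod_principal_iff] at hev
        obtain ⟨l, hl, hl'⟩ := (mem_nhdsLT_iff_exists_Ioo_subset' hlt).1 hev
        obtain ⟨a, ha1, ha2⟩ := exists_between (max_lt hlt hl)
        have hosc : ∀ w ∈ Ico a u, ∀ σ ∈ J, ‖x w σ - x u (-(1 / 2))‖ ≤ η := fun w hw σ hσ =>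
          mem_closedBall_iff_norm.1
            (hl' ⟨((le_max_right _ _).trans_lt ha1).trans_le hw.1, hw.2⟩ σ hσ)
        have hpa : p ≤ a := (le_max_left _ _).trans ha1.le
        refine hmove a u (-(1 / 2)) hpa ha2 htI.2 neg_half_mem_J
          (fun w hw => hosc w ⟨hw.1.le, hw.2⟩) ?_ ?_ (hbelow a ⟨hpa, ha2⟩ _ half_mem_J)
        · intro σ hσ hσ'
          rw [le_antisymm hσ' hσ.1, sub_self, norm_zero]
          exact hη.le
        · rw [norm_sub_rev]
          exact hosc a ⟨le_rfl, ha2⟩ _ half_mem_J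
      · rintro t ⟨htS, ht⟩ y hy
        have htI : t ∈ Icc p q := ⟨ht.1, ht.2.le⟩
        -- Half of `η`, so that any two values over `(t, b]`, dynamic ones included, differ by at
        -- most `η`. No separate climbing of fibres is needed here.
        have hev := (hx.sbv.rightLim t (hpq htI)).eventually
          (Metric.closedBall_mem_nhds _ (half_pos hη))
        rw [eventually_prod_principal_iff] at hev
        obtain ⟨l, hl, hl'⟩ := (mem_nhdsGT_iff_exists_Ioo_subset' ht.2).1 hev
        obtain ⟨b, hb1, hb2⟩ := exists_between (lt_min (lt_min (mem_Ioi.1 hl) ht.2) (mem_Ioi.1 hy))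
        have hbl : b < l := hb2.trans_le ((min_le_left _ _).trans (min_le_left _ _))
        have hbq : b < q := hb2.trans_le ((min_le_left _ _).trans (min_le_right _ _))
        have hby : b < y := hb2.trans_le (min_le_right _ _)
        have hnear : ∀ w ∈ Ioc t b, ∀ σ ∈ J, ‖x w σ - x t (1 / 2)‖ ≤ η / 2 := fun w hw σ hσ =>
          mem_closedBall_iff_norm.1 (hl' ⟨hw.1, hw.2.trans_lt hbl⟩ σ hσ)
        have hosc : ∀ w ∈ Ioc t b, ∀ σ ∈ J, ∀ w' ∈ Ioc t b, ∀ σ' ∈ J,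
            ‖x w σ - x w' σ'‖ ≤ η := by
          intro w hw σ hσ w' hw' σ' hσ'
          have h3 := hnear w hw σ hσ
          have h4 := hnear w' hw' σ' hσ'
          rw [norm_sub_rev] at h4
          have := norm_sub_le_norm_sub_add_norm_sub (x w σ) (x t (1 / 2)) (x w' σ')
          linarith
        refine ⟨b, fun u hu s hs => ?_, hb1, hby.le⟩
        rcases le_or_gt u t with hut | hut
        · exact htS u ⟨hu.1, hut⟩ s hs
        have hub : u ∈ Ioc t b := ⟨hut, hu.2⟩
        exact hmove t u s ht.1 hut (hu.2.trans hbq.le) hs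
          (fun w hw σ hσ => hosc w ⟨hw.1, hw.2.le.trans hu.2⟩ σ hσ u hub s hs)
          (fun σ hσ _ => hosc u hub σ hσ u hub s hs)
          ((hnear u hub s hs).trans (by linarith))
          (htS t ⟨ht.1, le_rfl⟩ _ half_mem_J)
    intro t ht s hs
    exact hsub ht t ⟨ht.1, le_rfl⟩ s hs
  rw [mem_closedBall_iff_norm]
  by_contra hcon
  have hpos : 0 < excess xs r (x q s) := lt_max_of_lt_left (sub_pos.2 (not_le.1 hcon))
  set c := excess xs r (x q s)
  set A := Real.exp (C * m.real (lexIic q s)) with hA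
  have hA0 : 0 < A := Real.exp_pos _
  -- With this tolerance the bound reads `c + 2 * η ≤ c / 2`, which is impossible for positive `c`.
  have := key (c / (4 * A)) (by positivity) q ⟨h, le_rfl⟩ s hs
  have h5 : 2 * (c / (4 * A)) * A = c / 2 := by field_simp; norm_num
  rw [← hA, h5] at this
  have h6 : 0 < 2 * (c / (4 * A)) := by positivity
  linarith

end

end DynDist

end

/-! ### Uniform stability -/

theorem corollary2 {n : ℕ} (a t₀ : EReal) (hat : a ≤ t₀)
    (D : Set (EuclideanSpace ℝ (Fin n))) (hD : IsOpen D)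
    (f : EuclideanSpace ℝ (Fin n) → EuclideanSpace ℝ (Fin n))
    (g : EuclideanSpace ℝ (Fin n) → Matrix (Fin n) (Fin n) ℝ)
    (hf : ∃ K, LipschitzOnWith K f D)
    (hg : ∀ i j, ∃ K, LipschitzOnWith K (fun x => g x i j) D)
    (v : DynDist.Impulse n) (hv : v.Admissible (DynDist.ray a))
    (xs : EuclideanSpace ℝ (Fin n)) (hxs : xs ∈ D)
    (heq : DynDist.IsSolution D f g v (DynDist.ray a) (fun _ _ => xs))
    (h₁ : ∀ t : ℝ, t₀ < (t : EReal) → ∀ l : ℕ, 1 ≤ l → ∀ x ∈ D, ‖x - xs‖ = 1 / (l : ℝ) →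
      inner ℝ (x - xs) (f x + DynDist.mulV (g x) (v.w t)) ≤ 0)
    (h₂ : ∀ s ∈ DynDist.J, ∀ k : ℕ, ∀ l : ℕ, 1 ≤ l → ∀ x ∈ D, ‖x - xs‖ = 1 / (l : ℝ) →
      inner ℝ (x - xs) (DynDist.mulV (g x) (DynDist.cmul (v.c k) (v.α k s))) ≤ 0) :
    DynDist.UniformlyStable D f g v (DynDist.ray a)
      {t : ℝ | a < (t : EReal) ∧ t₀ ≤ (t : EReal)} xs := by
  obtain ⟨ε, hε, hεD⟩ := Metric.nhds_basis_closedBall.mem_iff.1 (hD.mem_nhds hxs)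
  obtain ⟨N, hN⟩ := exists_nat_one_div_lt hε
  have hradius : ∀ k : ℕ, 1 / ((k + N + 1 : ℕ) : ℝ) ≤ 1 / ((N : ℝ) + 1) := fun k => by
    push_cast
    gcongr
    linarith [(Nat.cast_nonneg k : (0 : ℝ) ≤ k)]
  have hsub : ∀ k : ℕ, Metric.closedBall xs (1 / ((k + N + 1 : ℕ) : ℝ)) ⊆ D := fun k =>
    (Metric.closedBall_subset_closedBall ((hradius k).trans hN.le)).trans hεD
  -- The shift by `N + 1` puts all balls inside `D` and makes the radii of the form `1 / l` with `l
  -- ≥ 1`.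
  refine ⟨fun k => Metric.closedBall xs (1 / ((k + N + 1 : ℕ) : ℝ)),
    fun k => Metric.isClosed_closedBall, fun k l hkl => ?_, hsub,
    fun k => Metric.closedBall_mem_nhds _ (by positivity), fun U hU => ?_, fun l => ⟨l, le_rfl, ?_⟩⟩
  · refine Metric.closedBall_subset_closedBall ?_
    push_cast
    gcongr
  · obtain ⟨δ, hδ, hδU⟩ := Metric.nhds_basis_closedBall.mem_iff.1 hU
    obtain ⟨k, hk⟩ := exists_nat_one_div_lt hδ
    refine ⟨k, (Metric.closedBall_subset_closedBall (le_trans ?_ hk.le)).trans hδU⟩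
    push_cast
    gcongr
    linarith [(Nat.cast_nonneg N : (0 : ℝ) ≤ N)]
  · intro t₁ ht₁ Ω _ hΩ hΩI ht₁Ω x x₀ hx hlim hx₀ t ht htt s hs
    have hpq : Icc t₁ t ⊆ Ω := hΩ.out ht₁Ω ht
    have hpos : (0 : ℝ) < 1 / ((l + N + 1 : ℕ) : ℝ) := by positivity
    refine hx.mem_closedBall hv (hpq.trans hΩI) hpq htt hf hg hpos (hsub l) ?_ ?_ ?_ hs
    -- Moments strictly after `t₁ ≥ t₀` lie strictly after `t₀`, so the strict form of the tangency
    -- condition suffices even when `t₁ = t₀`.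
    · intro r hr z hz
      exact h₁ r (ht₁.2.trans_lt (EReal.coe_lt_coe_iff.2 hr)) (l + N + 1) (by omega) z
        (hsub l (mem_closedBall_iff_norm.2 hz.le)) hz
    · intro r hr k z hz
      exact h₂ r hr k (l + N + 1) (by omega) z (hsub l (mem_closedBall_iff_norm.2 hz.le)) hz
    · rwa [← hlim.unique (hx.sbv.leftLim t₁ ht₁Ω)]
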